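/- **Theorem 3.1.** Let $A=(A_0,A_1,A_2,A_3)\in\mathbb{C}^4$, put $a_0=2A_0-3$ and $a_i=A_i^2-(A_0-1)^2$ for $i=1,2,3$, and write $\partial_i=\partial/\partial t_i$, $\partial_{12}=\partial_1\partial_2$, etc. Let $Z_2(A)=\langle P_1,P_2\rangle$ be the system (left ideal) in the two variables $t_1,t_2$ generated by the differential operators $$P_1=(1-t_1^2)\partial_{11}+2(1-t_1t_2)\partial_{12}+(1-t_2^2)\partial_{22}+a_0(t_1\partial_1+t_2\partial_2)+a_3,$$ $$P_2=2(t_1-t_2)\{(1-t_2^2)\partial_{122}+a_0t_2\partial_{12}+a_1\partial_1+(1-t_1^2)\partial_{112}+a_0t_1\partial_{12}+a_2\partial_2\}$$ $$\qquad-(2+a_0)\{(1-t_2^2)\partial_{22}+a_0t_2\partial_2+a_1-(1-t_1^2)\partial_{11}-a_0t_1\partial_1-a_2\}.$$ Then $Z_2(A)$ has rank $6$, that is, with $R=\mathbb{C}(t_1,t_2)\langle\partial_1,\partial_2\rangle$, $$\dim_{\mathbb{C}(t_1,t_2)}R/(RP_1+RP_2)=6,$$ and the singular locus of $Z_2(A)$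 in $\mathbb{P}^1\times\mathbb{P}^1$ is $$\{t_1=\pm1\}\cup\{t_1=\infty\}\cup\{t_2=\pm1\}\cup\{t_2=\infty\}\cup\{t_1=t_2\}.$$ Here the singular locus is the set of points over which the characteristic variety (the common zeros of the principal symbols of all operators in the left ideal) contains a nonzero covector. The left ideal is taken in the ring of differential operators with polynomial coefficients in the affine coordinates $s_i=t_i$, or $s_i=1/t_i$ where $t_i=\infty$; at infinity the generators $P_1,P_2$ are rewritten in these coordinates and multiplied by the smallest powers of the $s_i=1/t_i$ that make (or keep) their coefficients polynomial. -/

import Mathlib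

open MvPolynomial

noncomputable section

namespace ZSystem

/-! ### Rational functions in two variables and differential operators on them

Indices are shifted by one: the variables `t₁, t₂` are indexed by `0, 1 : Fin 2`. -/

/-- The field `ℂ(t₁, t₂)` of rational functions. -/
abbrev RatFun : Type := FractionRing (MvPolynomial (Fin 2) ℂ)

/-- The coordinate function `tᵢ`. -/
def tvar (i : Fin 2) : RatFun := algebraMap (MvPolynomial (Fin 2) ℂ) RatFun (X i)

/-- The quotient rule `∂ᵢ (p / q) = (q ∂ᵢp - p ∂ᵢq) / q²`, as a function of `p` and `q`. -/
def quotientRule (i : Fin 2) (p q : MvPolynomial (Fin 2) ℂ) : RatFun :=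
  algebraMap (MvPolynomial (Fin 2) ℂ) RatFun (q * pderiv i p - p * pderiv i q) /
    algebraMap (MvPolynomial (Fin 2) ℂ) RatFun (q ^ 2)

theorem quotientRule_congr (i : Fin 2) {p q p' q' : MvPolynomial (Fin 2) ℂ}
    (hq : q ≠ 0) (hq' : q' ≠ 0) (h : p * q' = p' * q) :
    quotientRule i p q = quotientRule i p' q' := by
  have hinj := IsFractionRing.injective (MvPolynomial (Fin 2) ℂ) RatFun
  have h1 : algebraMap (MvPolynomial (Fin 2) ℂ) RatFun (q ^ 2) ≠ 0 := by
    rw [Ne, map_eq_zero_iff _ hinj]; exact pow_ne_zero 2 hq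
  have h2 : algebraMap (MvPolynomial (Fin 2) ℂ) RatFun (q' ^ 2) ≠ 0 := by
    rw [Ne, map_eq_zero_iff _ hinj]; exact pow_ne_zero 2 hq'
  have hd := congrArg (pderiv i) h
  simp only [Derivation.leibniz, smul_eq_mul] at hd
  rw [quotientRule, quotientRule, div_eq_div_iff h1 h2, ← map_mul, ← map_mul]
  congr 1
  linear_combination (q * q') * hd - (q' * pderiv i q + q * pderiv i q') * h

/-- The partial derivative `∂ᵢ` of a rational function, computed on some fraction representing it. -/
def pdFun (i : Fin 2) (f : RatFun) : RatFun :=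
  quotientRule i (IsLocalization.sec (nonZeroDivisors (MvPolynomial (Fin 2) ℂ)) f).1
    (IsLocalization.sec (nonZeroDivisors (MvPolynomial (Fin 2) ℂ)) f).2

/-- The quotient rule holds for every fraction representing `f`. -/
theorem pdFun_eq (i : Fin 2) {f : RatFun} {p q : MvPolynomial (Fin 2) ℂ} (hq : q ≠ 0)
    (h : f * algebraMap (MvPolynomial (Fin 2) ℂ) RatFun q =
      algebraMap (MvPolynomial (Fin 2) ℂ) RatFun p) :
    pdFun i f = quotientRule i p q := by
  have hinj := IsFractionRing.injective (MvPolynomial (Fin 2) ℂ) RatFun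
  have hs := IsLocalization.sec_spec (nonZeroDivisors (MvPolynomial (Fin 2) ℂ)) f
  refine quotientRule_congr i (nonZeroDivisors.ne_zero (SetLike.coe_mem _)) hq (hinj ?_)
  rw [map_mul, map_mul, ← hs, ← h]
  ring

theorem exists_fraction (f : RatFun) : ∃ p q : MvPolynomial (Fin 2) ℂ, q ≠ 0 ∧
    f * algebraMap (MvPolynomial (Fin 2) ℂ) RatFun q =
      algebraMap (MvPolynomial (Fin 2) ℂ) RatFun p :=
  ⟨_, _, nonZeroDivisors.ne_zero (SetLike.coe_mem _),
    IsLocalization.sec_spec (nonZeroDivisors (MvPolynomial (Fin 2) ℂ)) f⟩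

theorem smul_algebraMap (c : ℂ) (p : MvPolynomial (Fin 2) ℂ) :
    c • algebraMap (MvPolynomial (Fin 2) ℂ) RatFun p =
      algebraMap (MvPolynomial (Fin 2) ℂ) RatFun (c • p) :=
  (map_smul (IsScalarTower.toAlgHom ℂ (MvPolynomial (Fin 2) ℂ) RatFun) c p).symm

/-- The partial derivative `∂ᵢ = ∂/∂tᵢ`, as a `ℂ`-linear operator on `ℂ(t₁, t₂)`. -/
def pd (i : Fin 2) : Module.End ℂ RatFun where
  toFun := pdFun i
  map_add' f g := by
    have hinj := IsFractionRing.injective (MvPolynomial (Fin 2) ℂ) RatFun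
    obtain ⟨p, q, hq, hf⟩ := exists_fraction f
    obtain ⟨r, s, hs, hg⟩ := exists_fraction g
    have hfg : (f + g) * algebraMap (MvPolynomial (Fin 2) ℂ) RatFun (q * s) =
        algebraMap (MvPolynomial (Fin 2) ℂ) RatFun (p * s + r * q) := by
      simp only [map_mul, map_add, ← hf, ← hg]; ring
    rw [pdFun_eq i hq hf, pdFun_eq i hs hg, pdFun_eq i (mul_ne_zero hq hs) hfg]
    have h1 : algebraMap (MvPolynomial (Fin 2) ℂ) RatFun q ≠ 0 := by
      rwa [Ne, map_eq_zero_iff _ hinj]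
    have h2 : algebraMap (MvPolynomial (Fin 2) ℂ) RatFun s ≠ 0 := by
      rwa [Ne, map_eq_zero_iff _ hinj]
    simp only [quotientRule, Derivation.leibniz, smul_eq_mul, map_mul, map_add, map_sub, map_pow]
    field_simp
    ring
  map_smul' c f := by
    obtain ⟨p, q, hq, hf⟩ := exists_fraction f
    have hcf : (c • f) * algebraMap (MvPolynomial (Fin 2) ℂ) RatFun q =
        algebraMap (MvPolynomial (Fin 2) ℂ) RatFun (c • p) := by
      rw [smul_mul_assoc, hf, ← smul_algebraMap c p]
    rw [pdFun_eq i hq hf, pdFun_eq i hq hcf, RingHom.id_apply, quotientRule, quotientRule,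
      ← smul_div_assoc,
      smul_algebraMap]
    congr 2
    rw [Derivation.map_smul, smul_sub, mul_smul_comm, smul_mul_assoc]

/-- Multiplication by a rational function, as an operator on `ℂ(t₁, t₂)`. -/
def mulOp : RatFun →ₐ[ℂ] Module.End ℂ RatFun := Algebra.lmul ℂ RatFun

/-! ### The rank of a system -/

/-- The ring `ℂ(t₁, t₂)⟨∂₁, ∂₂⟩` of differential operators with rational coefficients. -/
def RatDiffOp : Subring (Module.End ℂ RatFun) :=
  Subring.closure (Set.range mulOp ∪ Set.range pd)

/-- A rational function as a differential operator of order `0`. -/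
def coeffHom : RatFun →+* RatDiffOp :=
  mulOp.toRingHom.codRestrict RatDiffOp fun f =>
    Subring.subset_closure (Or.inl (Set.mem_range_self f))

/-- The left ideal of `ℂ(t₁, t₂)⟨∂₁, ∂₂⟩` generated by a family of operators. (`Ideal` means left
ideal.) -/
def ratIdeal {ι : Type} (S : ι → Module.End ℂ RatFun) : Ideal RatDiffOp :=
  Ideal.span {Q | ∃ j, (Q : Module.End ℂ RatFun) = S j}

/-- The rank of the system `S`: the dimension over `ℂ(t₁, t₂)` (acting by left multiplication) of
the quotient of `ℂ(t₁, t₂)⟨∂₁, ∂₂⟩` by the left ideal generated by `S`. -/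
def rank {ι : Type} (S : ι → Module.End ℂ RatFun) : Cardinal :=
  letI : Module RatFun (RatDiffOp ⧸ ratIdeal S) := Module.compHom _ coeffHom
  Module.rank RatFun (RatDiffOp ⧸ ratIdeal S)

/-! ### The singular locus of a system in `ℙ¹ × ℙ¹`

A point of `ℙ¹ × ℙ¹` is a function `x : Fin 2 → OnePoint ℂ`. Around `x` we use the affine chart
of `ℙ¹ × ℙ¹` whose `i`-th coordinate is `tᵢ` if `x i` is finite and `1 / tᵢ` if `x i = ∞`. -/

open Classical in
/-- The `i`-th coordinate `sᵢ` of the chart at `x`: `tᵢ`, or `1 / tᵢ` if `x i = ∞`. -/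
def chartCoord (x : Fin 2 → OnePoint ℂ) (i : Fin 2) : RatFun :=
  if x i = OnePoint.infty then (tvar i)⁻¹ else tvar i

open Classical in
/-- The derivation `∂/∂sᵢ` in the chart at `x`: `∂/∂tᵢ`, or `-tᵢ² ∂/∂tᵢ` if `x i = ∞`. -/
def chartDer (x : Fin 2 → OnePoint ℂ) (i : Fin 2) : Module.End ℂ RatFun :=
  if x i = OnePoint.infty then -(mulOp (tvar i ^ 2) * pd i) else pd i

/-- The value at `x` of the coordinate `sᵢ` of the chart at `x`. -/
def chartValue (x : Fin 2 → OnePoint ℂ) (i : Fin 2) : ℂ :=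
  (x i).elim 0 id

/-- The ring `ℂ[s₁, s₂]⟨∂/∂s₁, ∂/∂s₂⟩` of differential operators with polynomial coefficients
on the chart at `x`. -/
def chartDiffOp (x : Fin 2 → OnePoint ℂ) : Subring (Module.End ℂ RatFun) :=
  Subring.closure (Set.range (fun f : MvPolynomial (Fin 2) ℂ => mulOp (aeval (chartCoord x) f)) ∪
    Set.range (chartDer x))

/-- The system `S` in the chart at `x`, as a left ideal of `chartDiffOp x`. At a finite point it is
the left ideal generated by `S`. If `x` has coordinates at infinity, the operators in `S`, written
in the coordinates `sᵢ`, may have poles along `sᵢ = 0`, and `S` is replaced by all its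
multiples by powers of these `sᵢ` that have polynomial coefficients (equivalently, by the multiples
by the smallest such powers). -/
def chartIdeal {ι : Type} (S : ι → Module.End ℂ RatFun) (x : Fin 2 → OnePoint ℂ) :
    Ideal (chartDiffOp x) :=
  Ideal.span {Q | ∃ (j : ι) (k : Fin 2 → ℤ), (∀ i, x i ≠ OnePoint.infty → k i = 0) ∧
    (Q : Module.End ℂ RatFun) = mulOp (∏ i, chartCoord x i ^ k i) * S j}

/-- The differential operator `∑ c_{mn}(s) (∂/∂s₁)ᵐ (∂/∂s₂)ⁿ` on the chart at `x` with full symbol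
`p = ∑ c_{mn}(s) ξ₁ᵐ ξ₂ⁿ`, a polynomial in `ξ` with coefficients in `ℂ[s₁, s₂]`. -/
def opOfSymbol (x : Fin 2 → OnePoint ℂ) (p : MvPolynomial (Fin 2) (MvPolynomial (Fin 2) ℂ)) :
    Module.End ℂ RatFun :=
  ∑ α ∈ p.support,
    mulOp (aeval (chartCoord x) (p.coeff α)) * (chartDer x 0 ^ α 0 * chartDer x 1 ^ α 1)

/-- The value at the covector `ξ` over the point `x` of the principal symbol of the operator with
full symbol `p`. -/
def principalSymbolAt (x : Fin 2 → OnePoint ℂ)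
    (p : MvPolynomial (Fin 2) (MvPolynomial (Fin 2) ℂ)) (ξ : Fin 2 → ℂ) : ℂ :=
  eval ξ (map (eval (chartValue x)) (homogeneousComponent p.totalDegree p))

/-- The fibre over `x` of the characteristic variety of the system `S`: the covectors at which the
principal symbols of all operators of the left ideal vanish. -/
def charFibre {ι : Type} (S : ι → Module.End ℂ RatFun) (x : Fin 2 → OnePoint ℂ) :
    Set (Fin 2 → ℂ) :=
  {ξ | ∀ Q ∈ chartIdeal S x, ∀ p, (Q : Module.End ℂ RatFun) = opOfSymbol x p →
    principalSymbolAt x p ξ = 0}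

/-- The singular locus of the system `S` in `ℙ¹ × ℙ¹`: the points over which the characteristic
variety contains a nonzero covector. -/
def singularLocus {ι : Type} (S : ι → Module.End ℂ RatFun) : Set (Fin 2 → OnePoint ℂ) :=
  {x | ∃ ξ ∈ charFibre S x, ξ ≠ 0}

/-! ### The system `Z₂(A)` -/

/-- The parameters `a₀ = 2A₀ - 3` and `aᵢ = Aᵢ² - (A₀ - 1)²` for `i = 1, 2, 3`. -/
def param (A : Fin 4 → ℂ) : Fin 4 → ℂ :=
  ![2 * A 0 - 3, A 1 ^ 2 - (A 0 - 1) ^ 2, A 2 ^ 2 - (A 0 - 1) ^ 2, A 3 ^ 2 - (A 0 - 1) ^ 2]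

/-- `P₁ = (1-t₁²)∂₁₁ + 2(1-t₁t₂)∂₁₂ + (1-t₂²)∂₂₂ + a₀(t₁∂₁+t₂∂₂) + a₃`. -/
def P₁ (A : Fin 4 → ℂ) : Module.End ℂ RatFun :=
  mulOp (1 - tvar 0 ^ 2) * (pd 0 * pd 0) + mulOp (2 * (1 - tvar 0 * tvar 1)) * (pd 0 * pd 1)
    + mulOp (1 - tvar 1 ^ 2) * (pd 1 * pd 1)
    + param A 0 • (mulOp (tvar 0) * pd 0 + mulOp (tvar 1) * pd 1)
    + param A 3 • 1

/-- `P₂ = 2(t₁-t₂){(1-t₂²)∂₁₂₂ + a₀t₂∂₁₂ + a₁∂₁ + (1-t₁²)∂₁₁₂ + a₀t₁∂₁₂ + a₂∂₂}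
- (2+a₀){(1-t₂²)∂₂₂ + a₀t₂∂₂ + a₁ - (1-t₁²)∂₁₁ - a₀t₁∂₁ - a₂}`. -/
def P₂ (A : Fin 4 → ℂ) : Module.End ℂ RatFun :=
  mulOp (2 * (tvar 0 - tvar 1)) *
      (mulOp (1 - tvar 1 ^ 2) * (pd 0 * pd 1 * pd 1)
        + param A 0 • (mulOp (tvar 1) * (pd 0 * pd 1)) + param A 1 • pd 0
        + mulOp (1 - tvar 0 ^ 2) * (pd 0 * pd 0 * pd 1)
        + param A 0 • (mulOp (tvar 0) * (pd 0 * pd 1)) + param A 2 • pd 1)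
    - (2 + param A 0) •
      (mulOp (1 - tvar 1 ^ 2) * (pd 1 * pd 1) + param A 0 • (mulOp (tvar 1) * pd 1) + param A 1 • 1
        - mulOp (1 - tvar 0 ^ 2) * (pd 0 * pd 0) - param A 0 • (mulOp (tvar 0) * pd 0)
        - param A 2 • 1)

/-- The system `Z₂(A) = ⟨P₁, P₂⟩`. -/
def Z₂ (A : Fin 4 → ℂ) : Fin 2 → Module.End ℂ RatFun := ![P₁ A, P₂ A]

end ZSystem

end

/-!
The proof rests on the fact that the two generators commute, `P₁ P₂ = P₂ P₁` (`P₁_mul_P₂`). Their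
principal symbols are
`σ₁ = ((1 - t₁)ξ₁ + (1 - t₂)ξ₂) ((1 + t₁)ξ₁ + (1 + t₂)ξ₂)` and
`σ₂ = 2 (t₁ - t₂) ξ₁ ξ₂ ((1 - t₁²)ξ₁ + (1 - t₂²)ξ₂)`, and they have no common factor
(`Chart.Frame.isRelPrime_sym`). So whenever the leading terms of `U P₁` and `V P₂` cancel, the
cancellation is a multiple of the trivial one, and as `P₂ P₁ - P₁ P₂ = 0` the orders of `U` and `V`
can be lowered without changing `U P₁ + V P₂`. Hence the principal symbols of all operators in the
left ideal lie in the ideal `(σ₁, σ₂)` (`Chart.exists_homogeneousComponent_eq`).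

The same argument works over the polynomial ring of every standard chart of `ℙ¹ × ℙ¹`. At infinity
`P₂` has to be replaced by a multiple `μ P₂`, where `μ` is a Laurent monomial in the coordinates at
infinity that depends on the parameters; then `μ P₂` no longer commutes with `P₁`, but
`(μ P₂) P₁ = (μ P₁ μ⁻¹) (μ P₂)`, and `μ P₁ μ⁻¹` still has polynomial coefficients and the principal
symbol of `P₁` (`Chart.Frame.exists_hasSymbol_conj`, `exists_symbol_chartIdeal`). The
characteristic variety is therefore given by the two principal symbols. The coordinate covector
belonging to `tᵢ` is a common zero where `tᵢ = ±1` or `tᵢ = ∞`, the covector `(1, -1)` is one on the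
diagonal, and elsewhere the only common zero is `0`.

Over the field `ℂ(t₁, t₂)`, the rank is the dimension of `ℂ(t₁, t₂)[ξ₁, ξ₂] / (σ₁, σ₂)`. The
monomials `1, ξ₁, ξ₂, ξ₁², ξ₁ξ₂, ξ₁²ξ₂` form a basis of it: they are independent because the symbols
in the ideal are known (`eq_zero_of_sum_mem_ratIdeal`), and they span because `(σ₁, σ₂)` contains
all monomials of degree at least `4` (`op_mem_of_basisSymbol_mem`).
-/

noncomputable section

namespace ZSystem

/-! ### Commutation of the generators -/

set_option maxRecDepth 20000 in
set_option maxHeartbeats 1000000 in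
/-- The operators `P₁` and `P₂`, written for any two commuting derivations with `D x = E y = 1` and
`D y = E x = 0`, commute: both composites expand to the same combination of iterated
derivatives. -/
theorem commute_of_derivations {R : Type*} [CommRing R] [Algebra ℂ R] (D E : Derivation ℂ R R)
    (hDE : ∀ f, E (D f) = D (E f)) {x y a₀ a₁ a₂ a₃ : R} (hDx : D x = 1) (hDy : D y = 0)
    (hEx : E x = 0) (hEy : E y = 1) (hD0 : D a₀ = 0) (hD1 : D a₁ = 0) (hD2 : D a₂ = 0)
    (hD3 : D a₃ = 0) (hE0 : E a₀ = 0) (hE1 : E a₁ = 0) (hE2 : E a₂ = 0) (hE3 : E a₃ = 0)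
    {p q : R → R}
    (hp : ∀ f, p f = (1 - x ^ 2) * D (D f) + 2 * (1 - x * y) * D (E f) + (1 - y ^ 2) * E (E f)
      + a₀ * (x * D f + y * E f) + a₃ * f)
    (hq : ∀ f, q f = 2 * (x - y) * ((1 - y ^ 2) * D (E (E f)) + a₀ * (y * D (E f)) + a₁ * D f
        + (1 - x ^ 2) * D (D (E f)) + a₀ * (x * D (E f)) + a₂ * E f)
      - (2 + a₀) * ((1 - y ^ 2) * E (E f) + a₀ * (y * E f) + a₁ * f
        - (1 - x ^ 2) * D (D f) - a₀ * (x * D f) - a₂ * f)) (f : R) :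
    p (q f) = q (p f) := by
  have h2 : D 2 = 0 := by simpa using D.map_natCast 2
  have h3 : E 2 = 0 := by simpa using E.map_natCast 2
  rw [hp (q f), hq (p f), hp f, hq f]
  simp only [pow_two, map_add, map_sub, Derivation.leibniz, smul_eq_mul, hDE, hDx, hDy, hEx,
    hEy, hD0, hD1, hD2, hD3, hE0, hE1, hE2, hE3, h2, h3, Derivation.map_one_eq_zero, mul_zero,
    add_zero, zero_add, mul_one, sub_zero, zero_sub, map_neg, mul_neg]
  ring

/-! ### The partial derivatives of rational functions -/

theorem mulOp_apply (f g : RatFun) : mulOp f g = f * g := rfl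

theorem smul_op_apply (c : ℂ) (T : Module.End ℂ RatFun) (f : RatFun) :
    (c • T) f = algebraMap ℂ RatFun c * T f :=
  Algebra.smul_def c (T f)

theorem algebraMap_ratFun_injective :
    Function.Injective (algebraMap (MvPolynomial (Fin 2) ℂ) RatFun) :=
  IsFractionRing.injective _ _

theorem pd_algebraMap (i : Fin 2) (p : MvPolynomial (Fin 2) ℂ) :
    pd i (algebraMap _ RatFun p) = algebraMap _ RatFun (pderiv i p) := by
  have h : pdFun i (algebraMap _ RatFun p) = quotientRule i p 1 :=
    pdFun_eq i one_ne_zero (by simp)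
  change pdFun i _ = _
  rw [h, quotientRule]
  simp

theorem pd_mul (i : Fin 2) (f g : RatFun) : pd i (f * g) = f * pd i g + g * pd i f := by
  have hinj := algebraMap_ratFun_injective
  obtain ⟨p, q, hq, hf⟩ := exists_fraction f
  obtain ⟨r, s, hs, hg⟩ := exists_fraction g
  have hfg : (f * g) * algebraMap (MvPolynomial (Fin 2) ℂ) RatFun (q * s) =
      algebraMap (MvPolynomial (Fin 2) ℂ) RatFun (p * r) := by
    simp only [map_mul, ← hf, ← hg]; ring
  change pdFun i _ = _ * pdFun i _ + _ * pdFun i _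
  rw [pdFun_eq i hq hf, pdFun_eq i hs hg, pdFun_eq i (mul_ne_zero hq hs) hfg]
  have h1 : algebraMap (MvPolynomial (Fin 2) ℂ) RatFun q ≠ 0 := by
    rwa [Ne, map_eq_zero_iff _ hinj]
  have h2 : algebraMap (MvPolynomial (Fin 2) ℂ) RatFun s ≠ 0 := by
    rwa [Ne, map_eq_zero_iff _ hinj]
  simp only [quotientRule, Derivation.leibniz, smul_eq_mul, map_mul, map_add, map_sub, map_pow,
    ← hf, ← hg]
  field_simp
  ring

/-- `∂ᵢ` as a derivation of `ℂ(t₁, t₂)`. -/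
def pdDer (i : Fin 2) : Derivation ℂ RatFun RatFun :=
  Derivation.mk' (pd i) fun f g => by simp only [pd_mul, smul_eq_mul]

theorem pdDer_apply (i : Fin 2) (f : RatFun) : pdDer i f = pd i f := rfl

theorem pd_tvar (i j : Fin 2) : pd i (tvar j) = if i = j then 1 else 0 := by
  rw [tvar, pd_algebraMap, pderiv_X]
  rcases eq_or_ne i j with rfl | h
  · simp
  · simp [h, h.symm]

theorem pderiv_pderiv_comm (p : MvPolynomial (Fin 2) ℂ) :
    pderiv 1 (pderiv 0 p) = pderiv 0 (pderiv 1 p) := by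
  induction p using MvPolynomial.induction_on' with
  | monomial α a =>
    ext m
    simp only [coeff_pderiv]
    rw [add_right_comm]
    simp
    split_ifs <;> ring
  | add p q hp hq => simp only [map_add, hp, hq]

/-- Both `∂₁∂₂` and `∂₂∂₁` are determined by their values on polynomials, as their difference is a
derivation. -/
theorem pd_pd_comm (f : RatFun) : pd 1 (pd 0 f) = pd 0 (pd 1 f) := by
  obtain ⟨p, q, hq, hf⟩ := exists_fraction f
  have hq' : algebraMap (MvPolynomial (Fin 2) ℂ) RatFun q ≠ 0 := by
    rwa [Ne, map_eq_zero_iff _ algebraMap_ratFun_injective]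
  have hpoly : ∀ r : MvPolynomial (Fin 2) ℂ, pd 1 (pd 0 (algebraMap _ RatFun r)) =
      pd 0 (pd 1 (algebraMap _ RatFun r)) := fun r => by
    rw [pd_algebraMap, pd_algebraMap, pd_algebraMap, pd_algebraMap, pderiv_pderiv_comm]
  have h := hpoly p
  have hQ := hpoly q
  rw [← hf] at h
  generalize algebraMap (MvPolynomial (Fin 2) ℂ) RatFun q = g at *
  rw [pd_mul 0, pd_mul 1, map_add, map_add, pd_mul, pd_mul, pd_mul, pd_mul, hQ] at h
  refine mul_left_cancel₀ hq' ?_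
  linear_combination h

/-- The generators of the system commute. -/
theorem P₁_mul_P₂ (A : Fin 4 → ℂ) : P₁ A * P₂ A = P₂ A * P₁ A := by
  ext f
  refine commute_of_derivations (pdDer 0) (pdDer 1) (x := tvar 0) (y := tvar 1)
    (a₀ := algebraMap ℂ RatFun (param A 0)) (a₁ := algebraMap ℂ RatFun (param A 1))
    (a₂ := algebraMap ℂ RatFun (param A 2)) (a₃ := algebraMap ℂ RatFun (param A 3))
    pd_pd_comm (by simp [pdDer_apply, pd_tvar]) (by simp [pdDer_apply, pd_tvar])
    (by simp [pdDer_apply, pd_tvar]) (by simp [pdDer_apply, pd_tvar]) (by simp) (by simp) (by simp)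
    (by simp) (by simp) (by simp) (by simp) (by simp) (p := P₁ A) (q := P₂ A) ?_ ?_ f
  · intro f
    simp only [P₁, LinearMap.add_apply, Module.End.mul_apply, mulOp_apply,
      smul_op_apply, Module.End.one_apply, pdDer_apply]
  · intro f
    simp only [P₂, LinearMap.add_apply, LinearMap.sub_apply, Module.End.mul_apply,
      mulOp_apply, smul_op_apply, Module.End.one_apply, pdDer_apply]
    simp only [map_add, map_ofNat]

/-! ### Polynomials of bounded degree -/

section DegLT

variable {B : Type*} [CommRing B]

/-- The polynomials in `ξ₁, ξ₂` of total degree `< n`; for `n = 0` this is only the zero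
polynomial. -/
def degLT (B : Type*) [CommRing B] (n : ℕ) : Submodule B (MvPolynomial (Fin 2) B) where
  carrier := {p | ∀ α : Fin 2 →₀ ℕ, n ≤ α.degree → coeff α p = 0}
  add_mem' hp hq α h := by rw [coeff_add, hp α h, hq α h, add_zero]
  zero_mem' α _ := coeff_zero α
  smul_mem' b p hp α h := by rw [coeff_smul, hp α h, smul_zero]

theorem degLT_mono {m n : ℕ} (h : m ≤ n) : degLT B m ≤ degLT B n :=
  fun _ hp α hα => hp α (h.trans hα)

theorem eq_zero_of_mem_degLT_zero {p : MvPolynomial (Fin 2) B} (hp : p ∈ degLT B 0) : p = 0 := by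
  ext α
  rw [hp α (Nat.zero_le _), coeff_zero]

theorem degree_lt_of_mem_support {n : ℕ} {p : MvPolynomial (Fin 2) B} (hp : p ∈ degLT B n)
    {α : Fin 2 →₀ ℕ} (hα : α ∈ p.support) : α.degree < n := by
  by_contra h
  exact mem_support_iff.mp hα (hp α (not_lt.mp h))

theorem mem_degLT_of_isHomogeneous {n : ℕ} {p : MvPolynomial (Fin 2) B} (hp : p.IsHomogeneous n) :
    p ∈ degLT B (n + 1) := fun α h => by
  refine hp.coeff_eq_zero ?_
  omega

theorem mem_degLT_totalDegree (p : MvPolynomial (Fin 2) B) : p ∈ degLT B (p.totalDegree + 1) :=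
  fun _ h => coeff_eq_zero_of_totalDegree_lt (Nat.lt_of_succ_le h)

theorem totalDegree_le_of_mem_degLT {n : ℕ} {p : MvPolynomial (Fin 2) B}
    (hp : p ∈ degLT B (n + 1)) : p.totalDegree ≤ n := by
  refine Finset.sup_le fun α hα => ?_
  exact Nat.lt_succ_iff.mp (degree_lt_of_mem_support hp hα)

theorem mul_mem_degLT {m n : ℕ} {p q : MvPolynomial (Fin 2) B} (hp : p ∈ degLT B (m + 1))
    (hq : q ∈ degLT B n) : p * q ∈ degLT B (m + n) := fun α h => by
  classical
  rw [coeff_mul]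
  refine Finset.sum_eq_zero fun x hx => ?_
  have hx' : x.1.degree + x.2.degree = α.degree := by
    rw [← map_add, Finset.HasAntidiagonal.mem_antidiagonal.mp hx]
  rcases Nat.lt_or_ge m x.1.degree with h1 | h1
  · rw [hp _ h1, zero_mul]
  · rw [hq _ (by omega), mul_zero]

theorem sub_homogeneousComponent_mem_degLT {n : ℕ} {p : MvPolynomial (Fin 2) B}
    (hp : p ∈ degLT B (n + 1)) : p - homogeneousComponent n p ∈ degLT B n := fun α h => by
  rw [coeff_sub, coeff_homogeneousComponent]
  split_ifs with hα
  · exact sub_self _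
  · rw [hp α (by omega), sub_zero]

theorem homogeneousComponent_eq_zero_of_mem_degLT {n : ℕ} {p : MvPolynomial (Fin 2) B}
    (hp : p ∈ degLT B n) : homogeneousComponent n p = 0 := by
  ext α
  rw [coeff_homogeneousComponent, coeff_zero]
  split_ifs with h
  · exact hp α h.ge
  · rfl

end DegLT

/-! ### Coordinate charts and full symbols -/

/-- A coordinate system on `ℂ(t₁, t₂)` with coefficient ring `B`: an embedding `φ` of `B`, two
commuting derivations `d i` preserving `B` (the restrictions are `δ i`), and coordinates `s i` in
`B` with `d i (s j) = δᵢⱼ`. Both `B = ℂ[s₁, s₂]` and `B = ℂ(t₁, t₂)` occur. -/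
structure Chart (B : Type*) [CommRing B] where
  φ : B →+* RatFun
  d : Fin 2 → Module.End ℂ RatFun
  s : Fin 2 → B
  δ : Fin 2 → B → B
  inj : Function.Injective φ
  leibniz : ∀ i f g, d i (f * g) = f * d i g + g * d i f
  comm : d 1 * d 0 = d 0 * d 1
  d_s : ∀ i j, d i (φ (s j)) = if i = j then 1 else 0
  φ_δ : ∀ i b, φ (δ i b) = d i (φ b)

namespace Chart

variable {B : Type*} [CommRing B] (c : Chart B)

/-- The derivation underlying `c.d i`. -/
def der (i : Fin 2) : Derivation ℂ RatFun RatFun :=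
  Derivation.mk' (c.d i) fun f g => by simp only [c.leibniz, smul_eq_mul]

theorem der_apply (i : Fin 2) (f : RatFun) : c.der i f = c.d i f := rfl

theorem δ_zero (i : Fin 2) : c.δ i 0 = 0 := c.inj (by rw [c.φ_δ, map_zero, map_zero])

theorem d_mul_mulOp (i : Fin 2) (f : RatFun) :
    c.d i * mulOp f = mulOp f * c.d i + mulOp (c.d i f) := by
  ext g
  simp only [Module.End.mul_apply, LinearMap.add_apply, mulOp_apply, c.leibniz]
  ring

/-- The monomial `∂₁ᵐ ∂₂ⁿ`. -/
def dMon (α : Fin 2 →₀ ℕ) : Module.End ℂ RatFun := c.d 0 ^ α 0 * c.d 1 ^ α 1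

/-- The differential operator `∑ c_{mn} ∂₁ᵐ ∂₂ⁿ` with full symbol `∑ c_{mn} ξ₁ᵐ ξ₂ⁿ`. -/
def op (p : MvPolynomial (Fin 2) B) : Module.End ℂ RatFun :=
  ∑ α ∈ p.support, mulOp (c.φ (p.coeff α)) * c.dMon α

theorem op_eq_sum {p : MvPolynomial (Fin 2) B} {t : Finset (Fin 2 →₀ ℕ)} (h : p.support ⊆ t) :
    c.op p = ∑ α ∈ t, mulOp (c.φ (p.coeff α)) * c.dMon α := by
  refine Finset.sum_subset h fun α _ hα => ?_
  rw [notMem_support_iff.mp hα, map_zero, map_zero, zero_mul]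

theorem op_add (p q : MvPolynomial (Fin 2) B) : c.op (p + q) = c.op p + c.op q := by
  classical
  rw [c.op_eq_sum (support_add (p := p) (q := q)),
    c.op_eq_sum (Finset.subset_union_left (s₁ := p.support) (s₂ := q.support)),
    c.op_eq_sum (Finset.subset_union_right (s₁ := p.support) (s₂ := q.support)),
    ← Finset.sum_add_distrib]
  simp only [coeff_add, map_add, add_mul]

/-- `op` as an additive map. -/
def opHom : MvPolynomial (Fin 2) B →+ Module.End ℂ RatFun := AddMonoidHom.mk' c.op c.op_add

theorem op_zero : c.op 0 = 0 := c.opHom.map_zero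

theorem op_neg (p : MvPolynomial (Fin 2) B) : c.op (-p) = -c.op p := c.opHom.map_neg p

theorem op_sub (p q : MvPolynomial (Fin 2) B) : c.op (p - q) = c.op p - c.op q :=
  c.opHom.map_sub p q

theorem op_sum {ι : Type*} (t : Finset ι) (f : ι → MvPolynomial (Fin 2) B) :
    c.op (∑ i ∈ t, f i) = ∑ i ∈ t, c.op (f i) :=
  map_sum c.opHom f t

theorem op_monomial (α : Fin 2 →₀ ℕ) (b : B) :
    c.op (monomial α b) = mulOp (c.φ b) * c.dMon α := by
  classical
  rw [c.op_eq_sum support_monomial_subset, Finset.sum_singleton, coeff_monomial, if_pos rfl]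

theorem op_C_mul (b : B) (p : MvPolynomial (Fin 2) B) :
    c.op (C b * p) = mulOp (c.φ b) * c.op p := by
  have h : (C b * p).support ⊆ p.support := by
    rw [← smul_eq_C_mul]; exact support_smul
  rw [c.op_eq_sum h, op, Finset.mul_sum]
  simp only [coeff_C_mul, map_mul, mul_assoc]

theorem op_C (b : B) : c.op (C b) = mulOp (c.φ b) := by
  rw [← monomial_zero', op_monomial]
  simp [dMon]

theorem d_mul_dMon (i : Fin 2) (α : Fin 2 →₀ ℕ) :
    c.d i * c.dMon α = c.dMon (Finsupp.single i 1 + α) := by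
  have hc : Commute (c.d 1) (c.d 0) := c.comm
  fin_cases i
  · simp [dMon, pow_add, mul_assoc]
  · simp [dMon, pow_add, ← mul_assoc, (hc.pow_right (α 0)).eq]

/-- Derivation of the coefficients of a polynomial. -/
def coeffDer (i : Fin 2) (p : MvPolynomial (Fin 2) B) : MvPolynomial (Fin 2) B :=
  ∑ α ∈ p.support, monomial α (c.δ i (p.coeff α))

theorem coeff_coeffDer (i : Fin 2) (p : MvPolynomial (Fin 2) B) (α : Fin 2 →₀ ℕ) :
    coeff α (c.coeffDer i p) = c.δ i (coeff α p) := by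
  classical
  rw [coeffDer, coeff_sum]
  simp only [coeff_monomial]
  rw [Finset.sum_ite_eq' p.support α fun β => c.δ i (p.coeff β)]
  split_ifs with h
  · rfl
  · rw [notMem_support_iff.mp h, c.δ_zero]

theorem coeffDer_mem_degLT {i : Fin 2} {n : ℕ} {p : MvPolynomial (Fin 2) B}
    (hp : p ∈ degLT B n) : c.coeffDer i p ∈ degLT B n := fun α h => by
  rw [coeff_coeffDer, hp α h, c.δ_zero]

theorem d_mul_op (i : Fin 2) (p : MvPolynomial (Fin 2) B) :
    c.d i * c.op p = c.op (X i * p + c.coeffDer i p) := by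
  have hX : X i * p = ∑ α ∈ p.support, monomial (Finsupp.single i 1 + α) (p.coeff α) := by
    conv_lhs => rw [← support_sum_monomial_coeff p, Finset.mul_sum]
    refine Finset.sum_congr rfl fun α _ => ?_
    rw [X, monomial_mul, one_mul]
  rw [op_add, hX, coeffDer, op_sum, op_sum, op, Finset.mul_sum, ← Finset.sum_add_distrib]
  refine Finset.sum_congr rfl fun α _ => ?_
  rw [op_monomial, op_monomial, ← mul_assoc, d_mul_mulOp, add_mul, mul_assoc, d_mul_dMon, c.φ_δ]

theorem d_pow_mul_op (k : Fin 2) (i : ℕ) {n : ℕ} {q : MvPolynomial (Fin 2) B}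
    (hq : q ∈ degLT B (n + 1)) :
    ∃ r ∈ degLT B (i + n), c.d k ^ i * c.op q = c.op (X k ^ i * q + r) := by
  induction i with
  | zero => exact ⟨0, zero_mem _, by simp⟩
  | succ i ih =>
    obtain ⟨r, hr, h⟩ := ih
    have hX : (X k : MvPolynomial (Fin 2) B) ∈ degLT B (1 + 1) :=
      mem_degLT_of_isHomogeneous (isHomogeneous_X B k)
    have hXi : X k ^ i * q ∈ degLT B (i + (n + 1)) := by
      refine mul_mem_degLT (mem_degLT_of_isHomogeneous ?_) hq
      simpa using (isHomogeneous_X B k).pow i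
    refine ⟨X k * r + c.coeffDer k (X k ^ i * q + r), ?_, ?_⟩
    · refine add_mem ?_ (c.coeffDer_mem_degLT (add_mem ?_ ?_))
      · exact degLT_mono (by omega) (mul_mem_degLT hX hr)
      · exact degLT_mono (by omega) hXi
      · exact degLT_mono (by omega) hr
    · rw [pow_succ', mul_assoc, h, d_mul_op]
      congr 1
      ring

theorem dMon_mul_op (α : Fin 2 →₀ ℕ) {n : ℕ} {q : MvPolynomial (Fin 2) B}
    (hq : q ∈ degLT B (n + 1)) :
    ∃ r ∈ degLT B (α.degree + n), c.dMon α * c.op q = c.op (monomial α 1 * q + r) := by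
  obtain ⟨r, hr, h⟩ := c.d_pow_mul_op 1 (α 1) hq
  have hX : ∀ k i, (X k : MvPolynomial (Fin 2) B) ^ i ∈ degLT B (i + 1) := fun k i =>
    mem_degLT_of_isHomogeneous (by simpa using (isHomogeneous_X B k).pow i)
  have hdeg : α.degree = α 0 + α 1 := by
    rw [Finsupp.degree_eq_sum, Fin.sum_univ_two]
  have hmon : monomial α (1 : B) = X 0 ^ α 0 * X 1 ^ α 1 := by
    rw [monomial_eq, C_1, one_mul, Finsupp.prod_fintype _ _ (by simp), Fin.prod_univ_two]
  obtain ⟨r', hr', h'⟩ := c.d_pow_mul_op 0 (α 0) (n := α 1 + n) (q := X 1 ^ α 1 * q + r)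
    (add_mem (degLT_mono (by omega) (mul_mem_degLT (hX 1 _) hq)) (degLT_mono (by omega) hr))
  refine ⟨X 0 ^ α 0 * r + r', add_mem ?_ ?_, ?_⟩
  · exact degLT_mono (by omega) (mul_mem_degLT (hX 0 _) hr)
  · exact degLT_mono (by omega) hr'
  · rw [dMon, mul_assoc, h, h', hmon]
    congr 1
    ring

/-- The full symbol of a composition is the product of the full symbols, up to terms of lower
order. -/
theorem op_mul_op {m n : ℕ} {p q : MvPolynomial (Fin 2) B} (hp : p ∈ degLT B m)
    (hq : q ∈ degLT B (n + 1)) :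
    ∃ r ∈ degLT B (m + n - 1), c.op p * c.op q = c.op (p * q + r) := by
  choose r hr h using fun α : Fin 2 →₀ ℕ => c.dMon_mul_op α hq
  refine ⟨∑ α ∈ p.support, C (coeff α p) * r α, sum_mem fun α hα => ?_, ?_⟩
  · have := degree_lt_of_mem_support hp hα
    rw [← smul_eq_C_mul]
    exact Submodule.smul_mem _ _ (degLT_mono (by omega) (hr α))
  · have hpq : p * q = ∑ α ∈ p.support, C (coeff α p) * (monomial α 1 * q) := by
      conv_lhs => rw [← support_sum_monomial_coeff p, Finset.sum_mul]
      refine Finset.sum_congr rfl fun α _ => ?_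
      rw [← mul_assoc, C_mul_monomial, mul_one]
    rw [hpq, ← Finset.sum_add_distrib, op_sum]
    conv_lhs => rw [op, Finset.sum_mul]
    refine Finset.sum_congr rfl fun α _ => ?_
    rw [← mul_add, op_C_mul, ← h α, mul_assoc]

/-! ### Uniqueness of the full symbol -/

theorem d_pow_apply (k : Fin 2) {g : RatFun} (hg : c.d k g = 0) (i m : ℕ) :
    (c.d k ^ i) (g * c.φ (c.s k) ^ m) =
      (m.descFactorial i : RatFun) * g * c.φ (c.s k) ^ (m - i) := by
  induction i with
  | zero => simp
  | succ i ih =>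
    have h1 : c.d k ((m.descFactorial i : RatFun) * g) = 0 := by
      rw [c.leibniz, hg, ← c.der_apply k (m.descFactorial i : RatFun), Derivation.map_natCast]
      simp
    have h2 : c.d k (c.φ (c.s k) ^ (m - i)) =
        ((m - i : ℕ) : RatFun) * c.φ (c.s k) ^ (m - i - 1) := by
      rw [← c.der_apply, Derivation.leibniz_pow, c.der_apply, c.d_s]
      simp
    rw [pow_succ', Module.End.mul_apply, ih, c.leibniz, h1, h2, Nat.descFactorial_succ,
      Nat.sub_sub]
    push_cast
    ring

theorem dMon_apply (α : Fin 2 →₀ ℕ) (m n : ℕ) :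
    c.dMon α (c.φ (c.s 0) ^ m * c.φ (c.s 1) ^ n) =
      (m.descFactorial (α 0) : RatFun) * (n.descFactorial (α 1) : RatFun) *
        (c.φ (c.s 0) ^ (m - α 0) * c.φ (c.s 1) ^ (n - α 1)) := by
  have h : ∀ i j : Fin 2, i ≠ j → ∀ k : ℕ, c.d i (c.φ (c.s j) ^ k) = 0 := fun i j hij k => by
    rw [← c.der_apply, Derivation.leibniz_pow, c.der_apply, c.d_s]
    simp [hij]
  rw [dMon, Module.End.mul_apply, c.d_pow_apply 1 (h 1 0 (by decide) m)]
  have h0 : c.d 0 ((n.descFactorial (α 1) : RatFun) * c.φ (c.s 1) ^ (n - α 1)) = 0 := by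
    rw [c.leibniz, h 0 1 (by decide), ← c.der_apply 0 (n.descFactorial (α 1) : RatFun),
      Derivation.map_natCast]
    simp
  have := c.d_pow_apply 0 h0 (α 0) m
  rw [mul_right_comm] at this
  rw [this]
  ring

/-- An operator determines its full symbol: the coefficient of a monomial of minimal degree is
found by applying the operator to the corresponding monomial in the coordinates. -/
theorem op_eq_zero {p : MvPolynomial (Fin 2) B} (h : c.op p = 0) : p = 0 := by
  by_contra hp
  obtain ⟨β, hβ, hmin⟩ := Finset.exists_min_image p.support (fun α => α.degree)
    (support_nonempty.mpr hp)
  have h1 : c.op p (c.φ (c.s 0) ^ β 0 * c.φ (c.s 1) ^ β 1) =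
      c.φ (coeff β p) * ((β 0).factorial * (β 1).factorial) := by
    rw [op, LinearMap.sum_apply, Finset.sum_eq_single β]
    · rw [Module.End.mul_apply, mulOp_apply, dMon_apply, Nat.descFactorial_self,
        Nat.descFactorial_self, Nat.sub_self, Nat.sub_self, pow_zero, pow_zero, mul_one, mul_one]
    · intro α hα hne
      have hdeg := hmin α hα
      simp only [Finsupp.degree_eq_sum, Fin.sum_univ_two] at hdeg
      rw [Module.End.mul_apply, mulOp_apply, dMon_apply]
      rcases Nat.lt_or_ge (β 0) (α 0) with h0 | h0
      · rw [Nat.descFactorial_of_lt h0]; simp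
      rcases Nat.lt_or_ge (β 1) (α 1) with h1 | h1
      · rw [Nat.descFactorial_of_lt h1]; simp
      refine absurd (Finsupp.ext fun i => ?_) hne
      fin_cases i
      · change α 0 = β 0; omega
      · change α 1 = β 1; omega
    · exact fun h => absurd hβ h
  rw [h, LinearMap.zero_apply] at h1
  have h2 : ((β 0).factorial * (β 1).factorial : RatFun) ≠ 0 :=
    mul_ne_zero (Nat.cast_ne_zero.mpr (Nat.factorial_ne_zero _))
      (Nat.cast_ne_zero.mpr (Nat.factorial_ne_zero _))
  have h3 := (mul_eq_zero.mp h1.symm).resolve_right h2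
  exact mem_support_iff.mp hβ (c.inj (h3.trans c.φ.map_zero.symm))

theorem op_injective : Function.Injective c.op := fun p q h =>
  sub_eq_zero.mp (c.op_eq_zero (by rw [op_sub, h, sub_self]))

/-- The operators with a full symbol over `B` are those of the ring generated by `B` and the
`∂ᵢ`. -/
theorem mem_closure_iff (T : Module.End ℂ RatFun) :
    T ∈ Subring.closure (Set.range (fun b : B => mulOp (c.φ b)) ∪ Set.range c.d) ↔
      ∃ p, c.op p = T := by
  constructor
  · intro hT
    induction hT using Subring.closure_induction with
    | mem T hT =>
      rcases hT with ⟨b, rfl⟩ | ⟨i, rfl⟩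
      · exact ⟨C b, c.op_C b⟩
      · refine ⟨X i, ?_⟩
        have := c.d_mul_dMon i 0
        rw [X, op_monomial, ← add_zero (Finsupp.single i 1), ← this]
        simp [dMon]
    | zero => exact ⟨0, c.op_zero⟩
    | one => exact ⟨C 1, by rw [op_C, map_one, map_one]⟩
    | add T U _ _ hT hU =>
      obtain ⟨p, rfl⟩ := hT
      obtain ⟨q, rfl⟩ := hU
      exact ⟨p + q, c.op_add p q⟩
    | neg T _ hT =>
      obtain ⟨p, rfl⟩ := hT
      exact ⟨-p, c.op_neg p⟩
    | mul T U _ _ hT hU =>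
      obtain ⟨p, rfl⟩ := hT
      obtain ⟨q, rfl⟩ := hU
      obtain ⟨r, -, h⟩ := c.op_mul_op (mem_degLT_totalDegree p) (mem_degLT_totalDegree q)
      exact ⟨_, h.symm⟩
  · rintro ⟨p, rfl⟩
    have hd : ∀ i, c.d i ∈
        Subring.closure (Set.range (fun b : B => mulOp (c.φ b)) ∪ Set.range c.d) :=
      fun i => Subring.subset_closure (Or.inr ⟨i, rfl⟩)
    exact Subring.sum_mem _ fun α _ => Subring.mul_mem _ (Subring.subset_closure (Or.inl ⟨_, rfl⟩))
      (Subring.mul_mem _ (Subring.pow_mem _ (hd 0) _) (Subring.pow_mem _ (hd 1) _))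

end Chart

namespace Chart

/-! ### Principal symbols -/

section Symbol

variable {B : Type*} [CommRing B] (c : Chart B)

/-- `P` has order at most `n`, and the part of degree `n` of its full symbol is `σ`. Here `σ = 0` is
allowed; it means that the order is less than `n`. -/
def HasSymbol (P : Module.End ℂ RatFun) (n : ℕ) (σ : MvPolynomial (Fin 2) B) : Prop :=
  ∃ p, c.op p = P ∧ σ.IsHomogeneous n ∧ p - σ ∈ degLT B n

variable {c} {P Q : Module.End ℂ RatFun} {m n : ℕ} {σ τ : MvPolynomial (Fin 2) B}

theorem mem_degLT_of_sub_mem {p : MvPolynomial (Fin 2) B} (hσ : σ.IsHomogeneous n)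
    (h : p - σ ∈ degLT B n) : p ∈ degLT B (n + 1) := by
  rw [← sub_add_cancel p σ]
  exact add_mem (degLT_mono n.le_succ h) (mem_degLT_of_isHomogeneous hσ)

theorem HasSymbol.isHomogeneous (h : c.HasSymbol P n σ) : σ.IsHomogeneous n := by
  obtain ⟨p, -, h, -⟩ := h
  exact h

theorem HasSymbol.congr (h : c.HasSymbol P n σ) (e : σ = τ) : c.HasSymbol P n τ := e ▸ h

theorem HasSymbol.add (hP : c.HasSymbol P n σ) (hQ : c.HasSymbol Q n τ) :
    c.HasSymbol (P + Q) n (σ + τ) := by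
  obtain ⟨p, rfl, hσ, hp⟩ := hP
  obtain ⟨q, rfl, hτ, hq⟩ := hQ
  exact ⟨p + q, c.op_add p q, hσ.add hτ, by rw [add_sub_add_comm]; exact add_mem hp hq⟩

theorem HasSymbol.neg (hP : c.HasSymbol P n σ) : c.HasSymbol (-P) n (-σ) := by
  obtain ⟨p, rfl, hσ, hp⟩ := hP
  exact ⟨-p, c.op_neg p, hσ.neg, by rw [neg_sub_neg, ← neg_sub]; exact neg_mem hp⟩

theorem HasSymbol.sub (hP : c.HasSymbol P n σ) (hQ : c.HasSymbol Q n τ) :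
    c.HasSymbol (P - Q) n (σ - τ) := by
  rw [sub_eq_add_neg, sub_eq_add_neg]
  exact hP.add hQ.neg

theorem HasSymbol.mul (hP : c.HasSymbol P m σ) (hQ : c.HasSymbol Q n τ) :
    c.HasSymbol (P * Q) (m + n) (σ * τ) := by
  obtain ⟨p, rfl, hσ, hp⟩ := hP
  obtain ⟨q, rfl, hτ, hq⟩ := hQ
  obtain ⟨r, hr, h⟩ := c.op_mul_op (mem_degLT_of_sub_mem hσ hp) (mem_degLT_of_sub_mem hτ hq)
  refine ⟨p * q + r, h.symm, hσ.mul hτ, ?_⟩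
  have e : p * q + r - σ * τ = τ * (p - σ) + p * (q - τ) + r := by ring
  rw [e]
  refine add_mem (add_mem ?_ ?_) ?_
  · exact degLT_mono (by omega) (mul_mem_degLT (mem_degLT_of_isHomogeneous hτ) hp)
  · exact mul_mem_degLT (mem_degLT_of_sub_mem hσ hp) hq
  · exact degLT_mono (by omega) hr

theorem HasSymbol.of_lt (hP : c.HasSymbol P m σ) (h : m < n) : c.HasSymbol P n 0 := by
  obtain ⟨p, rfl, hσ, hp⟩ := hP
  refine ⟨p, rfl, isHomogeneous_zero _ _ _, ?_⟩
  rw [sub_zero]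
  exact degLT_mono h (mem_degLT_of_sub_mem hσ hp)

theorem hasSymbol_mulOp (b : B) : c.HasSymbol (mulOp (c.φ b)) 0 (C b) :=
  ⟨C b, c.op_C b, isHomogeneous_C _ _, by rw [sub_self]; exact zero_mem _⟩

theorem hasSymbol_d (i : Fin 2) : c.HasSymbol (c.d i) 1 (X i) := by
  refine ⟨X i, ?_, isHomogeneous_X _ _, by rw [sub_self]; exact zero_mem _⟩
  have := c.d_mul_dMon i 0
  rw [X, op_monomial, ← add_zero (Finsupp.single i 1), ← this]
  simp [dMon]

theorem HasSymbol.mulOp_mul (b : B) (hP : c.HasSymbol P n σ) :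
    c.HasSymbol (mulOp (c.φ b) * P) n (C b * σ) := by
  simpa using (hasSymbol_mulOp b).mul hP

theorem hasSymbol_op_of_isHomogeneous (hσ : σ.IsHomogeneous n) : c.HasSymbol (c.op σ) n σ :=
  ⟨σ, rfl, hσ, by rw [sub_self]; exact zero_mem _⟩

end Symbol

/-! ### Principal symbols of the left ideal generated by two operators -/

section Regular

variable {B : Type*} [CommRing B] [IsDomain B] [UniqueFactorizationMonoid B] {c : Chart B}

/-- Suppose the principal symbols `σ₁, σ₂` of `P₁, P₂` have no common factor, and
`P₂ P₁ = P₁' P₂` with `P₁'` of the same principal symbol as `P₁`. Then the principal symbol of every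
operator of the form `U P₁ + V P₂` lies in the ideal `(σ₁, σ₂)`.

If the leading terms of `U P₁` and `V P₂` cancel, those of `U` and `V` are `w σ₂` and `-w σ₁` for
some `w`, and replacing `U, V` by `U - W P₂, V + W P₁'`, where `W` has full symbol `w`, lowers
their orders. -/
theorem exists_homogeneousComponent_eq {P₁ P₁' P₂ : Module.End ℂ RatFun}
    {σ₁ σ₂ : MvPolynomial (Fin 2) B} (h₁ : c.HasSymbol P₁ 2 σ₁) (h₁' : c.HasSymbol P₁' 2 σ₁)
    (h₂ : c.HasSymbol P₂ 3 σ₂) (hcomm : P₂ * P₁ = P₁' * P₂) (hσ₁ : σ₁ ≠ 0) (hσ₂ : σ₂ ≠ 0)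
    (hrel : IsRelPrime σ₁ σ₂) (N : ℕ) :
    ∀ u ∈ degLT B N, ∀ v ∈ degLT B (N - 1), ∀ q,
      c.op q = c.op u * P₁ + c.op v * P₂ → ∀ n, q ∈ degLT B (n + 1) →
        ∃ a ∈ degLT B (n - 1), ∃ b ∈ degLT B (n - 2),
          homogeneousComponent n q = a * σ₁ + b * σ₂ := by
  obtain ⟨p₁, rfl, hom₁, hp₁⟩ := h₁
  obtain ⟨p₁', rfl, -, hp₁'⟩ := h₁'
  obtain ⟨p₂, rfl, hom₂, hp₂⟩ := h₂
  have hp₁3 := mem_degLT_of_sub_mem hom₁ hp₁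
  have hp₁'3 := mem_degLT_of_sub_mem hom₁ hp₁'
  have hp₂4 := mem_degLT_of_sub_mem hom₂ hp₂
  induction N with
  | zero =>
    intro u hu v hv q hq n _
    have hq0 : q = 0 := c.op_eq_zero (by
      rw [hq, eq_zero_of_mem_degLT_zero hu, eq_zero_of_mem_degLT_zero hv, op_zero, zero_mul,
        zero_mul, add_zero])
    exact ⟨0, zero_mem _, 0, zero_mem _, by rw [hq0, map_zero, zero_mul, zero_mul, add_zero]⟩
  | succ N ih =>
    intro u hu v hv q hq n hqn
    rw [Nat.add_sub_cancel] at hv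
    have hu' : u - homogeneousComponent N u ∈ degLT B N := sub_homogeneousComponent_mem_degLT hu
    have hv' : v - homogeneousComponent (N - 1) v ∈ degLT B (N - 1) :=
      sub_homogeneousComponent_mem_degLT (degLT_mono (by omega) hv)
    have homu : (homogeneousComponent N u).IsHomogeneous N := homogeneousComponent_isHomogeneous _ _
    have homv : (homogeneousComponent (N - 1) v).IsHomogeneous (N - 1) :=
      homogeneousComponent_isHomogeneous _ _
    -- For `N = 0` the truncated index is harmless, since then `v = 0`.
    have hvN : homogeneousComponent (N - 1) v ∈ degLT B N := by
      have : homogeneousComponent (N - 1) v =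
        v - (v - homogeneousComponent (N - 1) v) := by ring
      rw [this]
      exact sub_mem hv (degLT_mono (by omega) hv')
    generalize homogeneousComponent N u = u₀ at *
    generalize homogeneousComponent (N - 1) v = v₀ at *
    have homvσ : (v₀ * σ₂).IsHomogeneous (N + 2) := by
      rcases Nat.eq_zero_or_pos N with rfl | hN
      · rw [eq_zero_of_mem_degLT_zero hvN, zero_mul]
        exact isHomogeneous_zero _ _ _
      · have := homv.mul hom₂
        rwa [show N - 1 + 3 = N + 2 by omega] at this
    have homtop : (u₀ * σ₁ + v₀ * σ₂).IsHomogeneous (N + 2) := (homu.mul hom₁).add homvσ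
    -- The part of degree `N + 2` of `q`.
    have hqtop : q - (u₀ * σ₁ + v₀ * σ₂) ∈ degLT B (N + 2) := by
      obtain ⟨r, hr, hur⟩ := c.op_mul_op hu hp₁3
      obtain ⟨r', hr', hvr⟩ := c.op_mul_op hv hp₂4
      have e : q = (u * p₁ + r) + (v * p₂ + r') := c.op_injective (by
        rw [hq, hur, hvr, c.op_add (u * p₁ + r)])
      have e' : q - (u₀ * σ₁ + v₀ * σ₂) =
          u * (p₁ - σ₁) + σ₁ * (u - u₀) + r + (v * (p₂ - σ₂) + σ₂ * (v - v₀) + r') := by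
        rw [e]; ring
      rw [e']
      have hv3 : v * (p₂ - σ₂) + σ₂ * (v - v₀) + r' ∈ degLT B (N + 2) := by
        refine add_mem (add_mem ?_ ?_) (degLT_mono (by omega) hr')
        · rcases Nat.eq_zero_or_pos N with rfl | hN
          · rw [eq_zero_of_mem_degLT_zero hv, zero_mul]
            exact zero_mem _
          · exact degLT_mono (m := N - 1 + 3) (by omega)
              (mul_mem_degLT (degLT_mono (by omega) hv) hp₂)
        · rcases Nat.eq_zero_or_pos N with rfl | hN
          · rw [eq_zero_of_mem_degLT_zero hv']
            simp
          · exact degLT_mono (by omega) (mul_mem_degLT (mem_degLT_of_isHomogeneous hom₂) hv')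
      refine add_mem (add_mem (add_mem ?_ ?_) (degLT_mono (by omega) hr)) hv3
      · exact mul_mem_degLT hu hp₁
      · exact degLT_mono (by omega) (mul_mem_degLT (mem_degLT_of_isHomogeneous hom₁) hu')
    have hcomp : homogeneousComponent (N + 2) q = u₀ * σ₁ + v₀ * σ₂ := by
      have := homogeneousComponent_eq_zero_of_mem_degLT hqtop
      rwa [map_sub, homogeneousComponent_eq_self homtop, sub_eq_zero] at this
    rcases lt_trichotomy n (N + 2) with hn | rfl | hn
    · -- The leading terms cancel.
      have h0 : u₀ * σ₁ + v₀ * σ₂ = 0 := by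
        rw [← hcomp]
        exact homogeneousComponent_eq_zero_of_mem_degLT (degLT_mono (by omega) hqn)
      obtain ⟨w, hw⟩ : σ₁ ∣ v₀ :=
        hrel.dvd_of_dvd_mul_right ⟨-u₀, by linear_combination h0⟩
      have hu0 : u₀ = -(w * σ₂) := by
        refine mul_right_cancel₀ hσ₁ ?_
        rw [hw] at h0
        linear_combination h0
      by_cases hw0 : w = 0
      · rw [hw0, zero_mul, neg_zero] at hu0
        rw [hw0, mul_zero] at hw
        rw [hu0, sub_zero] at hu'
        rw [hw, sub_zero] at hv'
        exact ih u hu' v hv' q hq n hqn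
      have hdeg : w.totalDegree + 3 = N := by
        rw [← hom₂.totalDegree hσ₂, ← totalDegree_mul_of_isDomain hw0 hσ₂, ← totalDegree_neg,
          ← hu0]
        exact homu.totalDegree (by rw [hu0]; exact neg_ne_zero.mpr (mul_ne_zero hw0 hσ₂))
      have hwN : w ∈ degLT B (N - 3 + 1) := by
        rw [← hdeg, Nat.add_sub_cancel]
        exact mem_degLT_totalDegree w
      obtain ⟨r, hr, hwr⟩ := c.op_mul_op hwN hp₂4
      obtain ⟨r', hr', hwr'⟩ := c.op_mul_op hwN hp₁'3
      refine ih (u + (w * p₂ + r)) ?_ (v - (w * p₁' + r')) ?_ q ?_ n hqn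
      · have e : u + (w * p₂ + r) = (u - u₀) + w * (p₂ - σ₂) + r := by
          rw [hu0]; ring
        rw [e]
        refine add_mem (add_mem hu' ?_) (degLT_mono (by omega) hr)
        exact degLT_mono (by omega) (mul_mem_degLT hwN hp₂)
      · have e : v - (w * p₁' + r') = (v - v₀) - w * (p₁' - σ₁) - r' := by
          rw [hw]; ring
        rw [e]
        refine sub_mem (sub_mem hv' ?_) (degLT_mono (by omega) hr')
        exact degLT_mono (by omega) (mul_mem_degLT hwN hp₁')
      · rw [op_add, op_sub, ← hwr, ← hwr', hq, add_mul, sub_mul, mul_assoc, mul_assoc, hcomm]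
        abel
    · exact ⟨u₀, mem_degLT_of_isHomogeneous homu, v₀, hvN, hcomp⟩
    · refine ⟨0, zero_mem _, 0, zero_mem _, ?_⟩
      rw [zero_mul, zero_mul, add_zero]
      refine homogeneousComponent_eq_zero_of_mem_degLT (degLT_mono hn ?_)
      exact mem_degLT_of_sub_mem homtop hqtop

end Regular

end Chart

/-! ### The generators in terms of the Euler operators `tᵢ∂ᵢ` -/

/-- The Euler operator `tᵢ∂ᵢ`. -/
def euler (i : Fin 2) : Module.End ℂ RatFun := mulOp (tvar i) * pd i

/-- The ordinary differential operator `(1 - tᵢ²)∂ᵢ² + a tᵢ∂ᵢ + b`. -/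
def legendreOp (a b : ℂ) (i : Fin 2) : Module.End ℂ RatFun :=
  pd i * pd i - euler i * euler i + (1 + a) • euler i + b • 1

theorem P₁_eq (A : Fin 4 → ℂ) :
    P₁ A = (pd 0 + pd 1) * (pd 0 + pd 1) - (euler 0 + euler 1) * (euler 0 + euler 1)
      + (1 + param A 0) • (euler 0 + euler 1) + param A 3 • 1 := by
  ext f
  simp only [P₁, euler, LinearMap.add_apply, LinearMap.sub_apply, Module.End.mul_apply,
    smul_op_apply, mulOp_apply, Module.End.one_apply]
  simp only [map_add, pd_mul, pd_tvar, map_one, pd_pd_comm, zero_ne_one, one_ne_zero, if_true,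
    if_false]
  ring

theorem P₂_eq (A : Fin 4 → ℂ) :
    P₂ A = mulOp (2 * (tvar 0 - tvar 1)) *
        (pd 0 * legendreOp (param A 0) (param A 1) 1 + pd 1 * legendreOp (param A 0) (param A 2) 0)
      - (2 + param A 0) •
        (legendreOp (param A 0) (param A 1) 1 - legendreOp (param A 0) (param A 2) 0) := by
  ext f
  have hc : ∀ (i : Fin 2) (z : ℂ), pd i (algebraMap ℂ RatFun z) = 0 := fun i z =>
    (pdDer i).map_algebraMap z
  simp only [P₂, legendreOp, euler, LinearMap.add_apply, LinearMap.sub_apply, Module.End.mul_apply,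
    smul_op_apply, mulOp_apply, Module.End.one_apply]
  simp only [map_add, map_sub, hc, pd_mul, pd_tvar, map_one, pd_pd_comm, zero_ne_one, one_ne_zero,
    if_true, if_false, mul_zero]
  ring

theorem tvar_zero_ne_tvar_one : tvar 0 ≠ tvar 1 := fun h => by
  have := congrArg (pd 0) h
  simp [pd_tvar] at this

theorem tvar_ne_zero (i : Fin 2) : tvar i ≠ 0 := fun h => by
  have := congrArg (pd i) h
  simp [pd_tvar] at this

theorem one_sub_tvar_sq_ne_zero (i : Fin 2) : 1 - tvar i ^ 2 ≠ 0 := fun h => by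
  have := congrArg (pd i) (sub_eq_zero.mp h).symm
  rw [← pdDer_apply, ← pdDer_apply, Derivation.map_one_eq_zero, Derivation.leibniz_pow,
    pdDer_apply, pd_tvar] at this
  simp [tvar_ne_zero] at this

/-! ### The principal symbols of the generators in a chart -/

/-- The relation between the coordinates `sᵢ` of a chart and `t₁, t₂`: the derivation `∂/∂tᵢ` is
`h i • d i` and `tᵢ ∂/∂tᵢ` is `g i • d i`, and `tᵢ` is the quotient of `num i` by `den i`. -/
structure Chart.Frame {B : Type*} [CommRing B] (c : Chart B) where
  h : Fin 2 → B
  g : Fin 2 → B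
  num : Fin 2 → B
  den : Fin 2 → B
  h_d : ∀ i, mulOp (c.φ (h i)) * c.d i = pd i
  g_eq : ∀ i, c.φ (g i) = tvar i * c.φ (h i)
  den_eq : ∀ i, c.φ (den i) * tvar i = c.φ (num i)
  den_ne_zero : ∀ i, den i ≠ 0
  const : ∀ z : ℂ, ∃ b, c.φ b = algebraMap ℂ RatFun z

namespace Chart

variable {B : Type*} [CommRing B] {c : Chart B}

namespace Frame

variable (F : c.Frame)

theorem h_ne_zero (i : Fin 2) : F.h i ≠ 0 := fun h => by
  have := LinearMap.congr_fun (F.h_d i) (tvar i)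
  rw [h, map_zero, map_zero, zero_mul, LinearMap.zero_apply, pd_tvar, if_pos rfl] at this
  exact zero_ne_one this

theorem g_d (i : Fin 2) : mulOp (c.φ (F.g i)) * c.d i = euler i := by
  rw [euler, ← F.h_d i, F.g_eq, map_mul, mul_assoc]

/-- The coefficient of `∂ᵢ²` in `P₁`. -/
def e (i : Fin 2) : B := F.h i ^ 2 - F.g i ^ 2

theorem φ_e (i : Fin 2) : c.φ (F.e i) = (1 - tvar i ^ 2) * c.φ (F.h i) ^ 2 := by
  rw [e, map_sub, map_pow, map_pow, F.g_eq]
  ring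

theorem e_ne_zero (i : Fin 2) : F.e i ≠ 0 := fun h => by
  have h1 := F.φ_e i
  rw [h, map_zero] at h1
  have h2 : c.φ (F.h i) ≠ 0 := (map_ne_zero_iff _ c.inj).mpr (F.h_ne_zero i)
  exact mul_ne_zero (one_sub_tvar_sq_ne_zero i) (pow_ne_zero 2 h2) h1.symm

theorem det_ne_zero : F.h 0 * F.g 1 - F.h 1 * F.g 0 ≠ 0 := fun h => by
  have h1 := congrArg c.φ h
  rw [map_sub, map_mul, map_mul, F.g_eq, F.g_eq, map_zero] at h1
  have h2 : ∀ i, c.φ (F.h i) ≠ 0 := fun i => (map_ne_zero_iff _ c.inj).mpr (F.h_ne_zero i)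
  refine mul_ne_zero (mul_ne_zero (h2 0) (h2 1)) (sub_ne_zero.mpr tvar_zero_ne_tvar_one) ?_
  linear_combination -h1

/-- The difference `t₁ - t₂`, freed of denominators. -/
def diff : B := F.den 1 * F.num 0 - F.den 0 * F.num 1

theorem φ_diff : c.φ F.diff = c.φ (F.den 0 * F.den 1) * (tvar 0 - tvar 1) := by
  rw [diff, map_sub, map_mul, map_mul, map_mul, ← F.den_eq, ← F.den_eq]
  ring

theorem diff_ne_zero : F.diff ≠ 0 := fun h => by
  have h1 := F.φ_diff
  rw [h, map_zero, map_mul] at h1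
  have h2 : ∀ i, c.φ (F.den i) ≠ 0 := fun i => (map_ne_zero_iff _ c.inj).mpr (F.den_ne_zero i)
  exact mul_ne_zero (mul_ne_zero (h2 0) (h2 1)) (sub_ne_zero.mpr tvar_zero_ne_tvar_one) h1.symm

/-- The principal symbol of `P₁`. -/
def sym₁ : MvPolynomial (Fin 2) B :=
  C (F.e 0) * X 0 ^ 2 + C (2 * (F.h 0 * F.h 1 - F.g 0 * F.g 1)) * (X 0 * X 1) + C (F.e 1) * X 1 ^ 2

/-- The principal symbol of `P₂`, multiplied by `den 0 * den 1`. -/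
def sym₂ : MvPolynomial (Fin 2) B :=
  C (2 * F.diff) * (X 0 * X 1 * (C (F.h 1 * F.e 0) * X 0 + C (F.h 0 * F.e 1) * X 1))

variable {F}

theorem hasSymbol_smul {P : Module.End ℂ RatFun} {n m : ℕ} {σ : MvPolynomial (Fin 2) B}
    (F : c.Frame) (hP : c.HasSymbol P n σ) (h : n < m) (z : ℂ) : c.HasSymbol (z • P) m 0 := by
  obtain ⟨b, hb⟩ := F.const z
  have e : z • P = mulOp (c.φ b) * P := by
    ext f
    rw [smul_op_apply, Module.End.mul_apply, mulOp_apply, hb]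
  rw [e]
  exact (hP.mulOp_mul b).of_lt h

theorem hasSymbol_smul_one (F : c.Frame) {m : ℕ} (h : 0 < m) (z : ℂ) :
    c.HasSymbol (z • (1 : Module.End ℂ RatFun)) m 0 := by
  have := hasSymbol_mulOp (c := c) 1
  rw [map_one, map_one] at this
  exact F.hasSymbol_smul this h z

/-- The symbol of `P₁` depends only on the leading terms of the operators `∂ᵢ` and `tᵢ∂ᵢ` out of
which it is composed. -/
theorem hasSymbol_sym₁ (F : c.Frame) {T G : Fin 2 → Module.End ℂ RatFun}
    (hT : ∀ i, c.HasSymbol (T i) 1 (C (F.h i) * X i))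
    (hG : ∀ i, c.HasSymbol (G i) 1 (C (F.g i) * X i)) (a b : ℂ) :
    c.HasSymbol ((T 0 + T 1) * (T 0 + T 1) - (G 0 + G 1) * (G 0 + G 1) + a • (G 0 + G 1) + b • 1) 2
      F.sym₁ := by
  have hT' := (hT 0).add (hT 1)
  have hG' := (hG 0).add (hG 1)
  refine ((((hT'.mul hT').sub (hG'.mul hG')).add (F.hasSymbol_smul hG' one_lt_two a)).add
    (F.hasSymbol_smul_one two_pos b)).congr ?_
  simp only [sym₁, e, C_mul, C_sub, C_pow, map_ofNat]
  ring

theorem hasSymbol_pd (F : c.Frame) (i : Fin 2) : c.HasSymbol (pd i) 1 (C (F.h i) * X i) := by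
  rw [← F.h_d i]
  exact (hasSymbol_d i).mulOp_mul _

theorem hasSymbol_euler (F : c.Frame) (i : Fin 2) : c.HasSymbol (euler i) 1 (C (F.g i) * X i) := by
  rw [← F.g_d i]
  exact (hasSymbol_d i).mulOp_mul _

theorem hasSymbol_P₁ (F : c.Frame) (A : Fin 4 → ℂ) : c.HasSymbol (P₁ A) 2 F.sym₁ := by
  rw [P₁_eq]
  exact F.hasSymbol_sym₁ F.hasSymbol_pd F.hasSymbol_euler _ _

theorem hasSymbol_legendreOp (F : c.Frame) (a b : ℂ) (i : Fin 2) :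
    c.HasSymbol (legendreOp a b i) 2 (C (F.e i) * X i ^ 2) := by
  have hT := F.hasSymbol_pd i
  have hG := F.hasSymbol_euler i
  refine ((((hT.mul hT).sub (hG.mul hG)).add (F.hasSymbol_smul hG one_lt_two _)).add
    (F.hasSymbol_smul_one two_pos b)).congr ?_
  simp only [e, C_sub, C_pow]
  ring

theorem hasSymbol_P₂ (F : c.Frame) (A : Fin 4 → ℂ) :
    c.HasSymbol (mulOp (c.φ (F.den 0 * F.den 1)) * P₂ A) 3 F.sym₂ := by
  have hx := F.hasSymbol_legendreOp (param A 0) (param A 2) 0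
  have hy := F.hasSymbol_legendreOp (param A 0) (param A 1) 1
  have e : mulOp (c.φ (F.den 0 * F.den 1)) * P₂ A = mulOp (c.φ (2 * F.diff)) *
      (pd 0 * legendreOp (param A 0) (param A 1) 1 + pd 1 * legendreOp (param A 0) (param A 2) 0)
      - mulOp (c.φ (F.den 0 * F.den 1)) * ((2 + param A 0) •
        (legendreOp (param A 0) (param A 1) 1 - legendreOp (param A 0) (param A 2) 0)) := by
    rw [P₂_eq, mul_sub, ← mul_assoc, ← map_mul mulOp, map_mul c.φ 2, F.φ_diff, map_ofNat]
    ring_nf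
  rw [e]
  refine (((((F.hasSymbol_pd 0).mul hy).add ((F.hasSymbol_pd 1).mul hx)).mulOp_mul _).sub
    ((F.hasSymbol_smul (hy.sub hx) (by norm_num) _).mulOp_mul _)).congr ?_
  simp only [sym₂, C_mul]
  ring

/-- Conjugation by a function `μ` whose logarithmic derivatives along `h i • d i` and `g i • d i`
lie in `B` does not change the principal symbol of `P₁`. -/
theorem exists_hasSymbol_conj (F : c.Frame) (A : Fin 4 → ℂ) {μ : RatFun}
    (hμ : ∀ i, ∃ b b', c.φ (F.h i) * c.d i μ = c.φ b * μ ∧ c.φ (F.g i) * c.d i μ = c.φ b' * μ) :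
    ∃ P, c.HasSymbol P 2 F.sym₁ ∧ mulOp μ * P₁ A = P * mulOp μ := by
  choose b b' hb hb' using hμ
  let T : Fin 2 → Module.End ℂ RatFun := fun i => pd i - mulOp (c.φ (b i))
  let G : Fin 2 → Module.End ℂ RatFun := fun i => euler i - mulOp (c.φ (b' i))
  have hT : ∀ i, SemiconjBy (mulOp μ) (pd i) (T i) := fun i => by
    ext f
    simp only [T, ← F.h_d i, Module.End.mul_apply, LinearMap.sub_apply, mulOp_apply, c.leibniz]
    linear_combination -f * hb i
  have hG : ∀ i, SemiconjBy (mulOp μ) (euler i) (G i) := fun i => by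
    ext f
    simp only [G, ← F.g_d i, Module.End.mul_apply, LinearMap.sub_apply, mulOp_apply, c.leibniz]
    linear_combination -f * hb' i
  have hs : ∀ (z : ℂ) {S S' : Module.End ℂ RatFun}, SemiconjBy (mulOp μ) S S' →
      SemiconjBy (mulOp μ) (z • S) (z • S') := fun z S S' h => by
    rw [SemiconjBy, mul_smul_comm, smul_mul_assoc, h.eq]
  refine ⟨_, F.hasSymbol_sym₁ (T := T) (G := G) (fun i => ?_) (fun i => ?_) (1 + param A 0)
    (param A 3), ?_⟩
  · exact ((F.hasSymbol_pd i).sub ((hasSymbol_mulOp _).of_lt one_pos)).congr (sub_zero _)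
  · exact ((F.hasSymbol_euler i).sub ((hasSymbol_mulOp _).of_lt one_pos)).congr (sub_zero _)
  · rw [P₁_eq]
    have hT' := (hT 0).add_right (hT 1)
    have hG' := (hG 0).add_right (hG 1)
    exact ((((hT'.mul_right hT').sub_right (hG'.mul_right hG')).add_right (hs _ hG')).add_right
      (hs _ (SemiconjBy.one_right _))).eq

/-! ### The principal symbols have no common factor -/

/-- A multiple of `ξ₁² ξ₂²` by a nonzero element of `B` lies in the ideal generated by the two
symbols. -/
theorem C_mul_X_sq_mul_X_sq (F : c.Frame) :
    C (2 * F.diff * (F.h 0 * F.g 1 - F.h 1 * F.g 0) ^ 2) * (X 0 ^ 2 * X 1 ^ 2) =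
      C (2 * F.diff * F.h 0 * F.h 1) * (X 0 * X 1) * F.sym₁
        - (C (F.h 0) * X 0 + C (F.h 1) * X 1) * F.sym₂ := by
  simp only [sym₁, sym₂, e, C_mul, C_sub, C_pow, map_ofNat]
  ring

theorem eval_single_sym₁ (F : c.Frame) (i : Fin 2) :
    eval (Pi.single i (1 : B)) F.sym₁ = F.e i := by
  fin_cases i <;> simp [sym₁]

theorem sym₁_ne_zero (F : c.Frame) : F.sym₁ ≠ 0 := fun h => by
  have := F.eval_single_sym₁ 0
  rw [h, map_zero] at this
  exact F.e_ne_zero 0 this.symm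

variable [IsDomain B]

theorem two_mul_diff_ne_zero (F : c.Frame) : 2 * F.diff ≠ 0 := by
  refine mul_ne_zero (fun h => ?_) F.diff_ne_zero
  have := congrArg c.φ h
  rw [map_ofNat, map_zero] at this
  exact two_ne_zero this

theorem sym₂_ne_zero (F : c.Frame) : F.sym₂ ≠ 0 := by
  have h : C (F.h 1 * F.e 0) * X 0 + C (F.h 0 * F.e 1) * X 1 ≠ (0 : MvPolynomial (Fin 2) B) :=
    fun h => by
      have := congrArg (eval ![1, 0]) h
      simp [F.e_ne_zero, F.h_ne_zero] at this
  exact mul_ne_zero (C_ne_zero.mpr F.two_mul_diff_ne_zero)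
    (mul_ne_zero (mul_ne_zero (X_ne_zero _) (X_ne_zero _)) h)

/-- A common prime factor of the two symbols divides a multiple of `ξ₁² ξ₂²` by a nonzero element
of `B`; it is neither `ξ₁` nor `ξ₂`, so it is constant and divides the coefficients of
`sym₁`. -/
theorem isRelPrime_sym [UniqueFactorizationMonoid B] (F : c.Frame)
    (he : IsRelPrime (F.e 0) (F.e 1)) : IsRelPrime F.sym₁ F.sym₂ := by
  refine WfDvdMonoid.isRelPrime_of_no_irreducible_factors (fun h => F.sym₁_ne_zero h.1) ?_
  intro π hπ h1 h2
  have hprime : Prime π := UniqueFactorizationMonoid.irreducible_iff_prime.mp hπ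
  have hX : ∀ i j : Fin 2, i ≠ j → ¬ π ∣ X i := fun i j hij hdvd => by
    have hi : X i ∣ F.sym₁ :=
      ((hprime.associated_of_dvd (X_prime (i := i)) hdvd).symm.dvd).trans h1
    obtain ⟨q, hq⟩ := hi
    have := congrArg (eval (Pi.single j (1 : B))) hq
    rw [F.eval_single_sym₁, map_mul, eval_X, Pi.single_eq_of_ne hij, zero_mul] at this
    exact F.e_ne_zero j this
  have hdvd : π ∣ C (2 * F.diff * (F.h 0 * F.g 1 - F.h 1 * F.g 0) ^ 2) * (X 0 ^ 2 * X 1 ^ 2) := by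
    rw [F.C_mul_X_sq_mul_X_sq]
    exact dvd_sub (h1.mul_left _) (h2.mul_left _)
  have hC : π ∣ C (2 * F.diff * (F.h 0 * F.g 1 - F.h 1 * F.g 0) ^ 2) := by
    rcases hprime.dvd_or_dvd hdvd with h | h
    · exact h
    · rcases hprime.dvd_or_dvd h with h | h
      · exact absurd (hprime.dvd_of_dvd_pow h) (hX 0 1 (by decide))
      · exact absurd (hprime.dvd_of_dvd_pow h) (hX 1 0 (by decide))
  have hne : 2 * F.diff * (F.h 0 * F.g 1 - F.h 1 * F.g 0) ^ 2 ≠ 0 :=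
    mul_ne_zero F.two_mul_diff_ne_zero (pow_ne_zero 2 F.det_ne_zero)
  obtain ⟨b, -, rfl⟩ := (dvd_C_iff_exists hne).mp hC
  have hb : ∀ i, b ∣ F.e i := fun i => by
    have := map_dvd (eval (Pi.single i (1 : B))) h1
    rwa [F.eval_single_sym₁, eval_C] at this
  exact hπ.not_isUnit ((he (hb 0) (hb 1)).map C)

end Frame

end Chart

/-! ### The standard charts of `ℙ¹ × ℙ¹` -/

section StandardChart

variable (x : Fin 2 → OnePoint ℂ)

open Classical in
theorem chartDer_apply (i : Fin 2) (f : RatFun) :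
    chartDer x i f = (if x i = OnePoint.infty then -tvar i ^ 2 else 1) * pd i f := by
  rw [chartDer]
  split_ifs
  · simp only [LinearMap.neg_apply, Module.End.mul_apply, mulOp_apply]
    ring
  · rw [one_mul]

theorem chartDer_leibniz (i : Fin 2) (f g : RatFun) :
    chartDer x i (f * g) = f * chartDer x i g + g * chartDer x i f := by
  rw [chartDer_apply, chartDer_apply, chartDer_apply, pd_mul]
  ring

theorem chartDer_comm : chartDer x 1 * chartDer x 0 = chartDer x 0 * chartDer x 1 := by
  have h : ∀ i j : Fin 2, i ≠ j → pd i (tvar j ^ 2) = 0 := fun i j hij => by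
    rw [← pdDer_apply, Derivation.leibniz_pow, pdDer_apply, pd_tvar]
    simp [hij]
  have h01 := h 0 1 (by decide)
  have h10 := h 1 0 (by decide)
  ext f
  simp only [Module.End.mul_apply, chartDer_apply]
  split_ifs <;> simp only [pd_mul, neg_mul, map_neg, h01, h10, pd_pd_comm, one_mul] <;> ring

theorem chartCoord_ne_zero (i : Fin 2) : chartCoord x i ≠ 0 := by
  rw [chartCoord]
  split_ifs
  · exact inv_ne_zero (tvar_ne_zero i)
  · exact tvar_ne_zero i

theorem chartDer_chartCoord (i j : Fin 2) :
    chartDer x i (chartCoord x j) = if i = j then 1 else 0 := by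
  have hinv : pd i (tvar j)⁻¹ = -(tvar j)⁻¹ ^ 2 * pd i (tvar j) := by
    rw [← pdDer_apply, Derivation.leibniz_inv, pdDer_apply, smul_eq_mul]
  have hj := tvar_ne_zero j
  rw [chartDer_apply, chartCoord]
  rcases eq_or_ne i j with rfl | hij
  · rw [if_pos rfl]
    split_ifs with h
    · rw [hinv, pd_tvar, if_pos rfl]
      field_simp
    · rw [pd_tvar, if_pos rfl, one_mul]
  · have h0 : pd i (tvar j) = 0 := by rw [pd_tvar, if_neg hij]
    rw [if_neg hij]
    split_ifs <;> simp [hinv, h0]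

theorem chartDer_aeval (i : Fin 2) (p : MvPolynomial (Fin 2) ℂ) :
    chartDer x i (aeval (chartCoord x) p) = aeval (chartCoord x) (pderiv i p) := by
  let D : Derivation ℂ RatFun RatFun :=
    Derivation.mk' (chartDer x i) fun f g => by rw [chartDer_leibniz, smul_eq_mul, smul_eq_mul]
  have hD : ∀ f, chartDer x i f = D f := fun _ => rfl
  induction p using MvPolynomial.induction_on with
  | C a => rw [aeval_C, pderiv_C, map_zero, hD, Derivation.map_algebraMap]
  | add p q hp hq => simp only [map_add, hp, hq]
  | mul_X p j hp =>
    rw [map_mul, aeval_X, chartDer_leibniz, hp, chartDer_chartCoord, Derivation.leibniz, pderiv_X]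
    rcases eq_or_ne i j with rfl | hij
    · simp
    · simp [hij, hij.symm]

theorem eq_zero_of_pderiv_eq_zero {p : MvPolynomial (Fin 2) ℂ} (h : ∀ i, pderiv i p = 0)
    (h0 : coeff 0 p = 0) : p = 0 := by
  ext α
  rw [coeff_zero]
  by_cases hα : α = 0
  · rw [hα, h0]
  obtain ⟨i, hi⟩ := Finsupp.ne_iff.mp hα
  have h1 := congrArg (coeff (α - Finsupp.single i 1)) (h i)
  rw [coeff_pderiv, coeff_zero, tsub_add_cancel_of_le] at h1
  · exact (mul_eq_zero.mp h1).resolve_right (Nat.cast_add_one_ne_zero _)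
  · rw [Finsupp.single_le_iff]
    exact Nat.one_le_iff_ne_zero.mpr hi

theorem pderiv_mem_degLT (i : Fin 2) {n : ℕ} {p : MvPolynomial (Fin 2) ℂ}
    (hp : p ∈ degLT ℂ (n + 1)) : pderiv i p ∈ degLT ℂ n := fun α hα => by
  rw [coeff_pderiv, hp, zero_mul]
  rw [map_add, Finsupp.degree_single]
  omega

/-- The coordinates of a chart are algebraically independent: the partial derivatives of an
algebraic relation of minimal degree would be relations of smaller degree. -/
theorem aeval_chartCoord_injective :
    Function.Injective (aeval (R := ℂ) (chartCoord x)) := by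
  have key : ∀ n : ℕ, ∀ p ∈ degLT ℂ n, aeval (chartCoord x) p = 0 → p = 0 := by
    intro n
    induction n with
    | zero => exact fun p hp _ => eq_zero_of_mem_degLT_zero hp
    | succ n ih =>
      intro p hp h
      have hpd : ∀ i, pderiv i p = 0 := fun i =>
        ih _ (pderiv_mem_degLT i hp) (by rw [← chartDer_aeval, h, map_zero])
      have hC : p = C (coeff 0 p) := by
        rw [← sub_eq_zero]
        exact eq_zero_of_pderiv_eq_zero (fun i => by rw [map_sub, hpd, pderiv_C, sub_zero])
          (by rw [coeff_sub, coeff_zero_C, sub_self])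
      rw [hC, aeval_C, map_eq_zero] at h
      rw [hC, h, C_0]
  exact (injective_iff_map_eq_zero _).mpr fun p => key _ p (mem_degLT_totalDegree p)

/-- The chart of `ℙ¹ × ℙ¹` at `x`, with coefficient ring `ℂ[s₁, s₂]`. -/
def chart : Chart (MvPolynomial (Fin 2) ℂ) where
  φ := (aeval (chartCoord x)).toRingHom
  d := chartDer x
  s := X
  δ i := pderiv i
  inj := aeval_chartCoord_injective x
  leibniz := chartDer_leibniz x
  comm := chartDer_comm x
  d_s i j := by
    change chartDer x i (aeval (chartCoord x) (X j)) = _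
    rw [aeval_X, chartDer_chartCoord]
  φ_δ i b := (chartDer_aeval x i b).symm

theorem chart_φ (p : MvPolynomial (Fin 2) ℂ) : (chart x).φ p = aeval (chartCoord x) p := rfl

theorem opOfSymbol_eq (p : MvPolynomial (Fin 2) (MvPolynomial (Fin 2) ℂ)) :
    opOfSymbol x p = (chart x).op p := rfl

theorem mem_chartDiffOp_iff (T : Module.End ℂ RatFun) :
    T ∈ chartDiffOp x ↔ ∃ p, (chart x).op p = T :=
  (chart x).mem_closure_iff T

open Classical in
/-- At a point at infinity, `s = 1 / t` gives `∂/∂t = -s² ∂/∂s` and `t ∂/∂t = -s ∂/∂s`. -/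
def frame : (chart x).Frame where
  h i := if x i = OnePoint.infty then -X i ^ 2 else 1
  g i := if x i = OnePoint.infty then -X i else X i
  num i := if x i = OnePoint.infty then 1 else X i
  den i := if x i = OnePoint.infty then X i else 1
  h_d i := by
    ext f
    have hi := tvar_ne_zero i
    rw [Module.End.mul_apply, mulOp_apply, chart_φ]
    change _ * chartDer x i f = _
    rw [chartDer_apply]
    split_ifs with h
    · rw [map_neg, map_pow, aeval_X, chartCoord, if_pos h]
      field_simp
    · simp
  g_eq i := by
    have hi := tvar_ne_zero i
    simp only [chart_φ]
    split_ifs with h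
    · rw [map_neg, map_neg, map_pow, aeval_X, chartCoord, if_pos h]
      field_simp
    · rw [aeval_X, chartCoord, if_neg h, map_one, mul_one]
  den_eq i := by
    have hi := tvar_ne_zero i
    simp only [chart_φ]
    split_ifs with h
    · rw [aeval_X, chartCoord, if_pos h, map_one, inv_mul_cancel₀ hi]
    · rw [aeval_X, chartCoord, if_neg h, map_one, one_mul]
  den_ne_zero i := by
    split_ifs
    · exact X_ne_zero i
    · exact one_ne_zero
  const z := ⟨C z, by rw [chart_φ, aeval_C]⟩

open Classical in
theorem frame_e (i : Fin 2) :
    (frame x).e i = if x i = OnePoint.infty then X i ^ 4 - X i ^ 2 else 1 - X i ^ 2 := by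
  simp only [Chart.Frame.e, frame]
  split_ifs <;> ring

theorem degreeOf_frame_e {i j : Fin 2} (h : i ≠ j) : degreeOf i ((frame x).e j) = 0 := by
  have hX : ∀ n : ℕ, degreeOf i ((X j : MvPolynomial (Fin 2) ℂ) ^ n) = 0 := fun n =>
    degreeOf_X_pow_of_ne n h
  rw [frame_e, ← Nat.le_zero]
  split_ifs
  · refine (degreeOf_sub_le _ _ _).trans ?_
    rw [hX, hX, max_self]
  · refine (degreeOf_sub_le _ _ _).trans ?_
    rw [hX, ← C_1, degreeOf_C, max_self]

/-- A common factor of a polynomial in `s₁` and a polynomial in `s₂` is constant. -/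
theorem isRelPrime_frame_e : IsRelPrime ((frame x).e 0) ((frame x).e 1) := by
  intro p h0 h1
  have hdeg : ∀ i j, i ≠ j → p ∣ (frame x).e j → degreeOf i p = 0 := fun i j hij hd => by
    obtain ⟨q, hq⟩ := hd
    have hpq : p * q ≠ 0 := hq ▸ (frame x).e_ne_zero j
    have := degreeOf_frame_e x hij
    rw [hq, degreeOf_mul_eq (left_ne_zero_of_mul hpq) (right_ne_zero_of_mul hpq)] at this
    omega
  have hd : ∀ i, degreeOf i p = 0 := fun i => by
    fin_cases i
    · exact hdeg 0 1 (by decide) h1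
    · exact hdeg 1 0 (by decide) h0
  have hC : p = C (coeff 0 p) := by
    rw [← totalDegree_eq_zero_iff_eq_C, totalDegree_eq_zero_iff]
    intro m hm i
    have := monomial_le_degreeOf i hm
    rw [hd] at this
    omega
  have hp0 : p ≠ 0 := by
    rintro rfl
    exact (frame x).e_ne_zero 0 (zero_dvd_iff.mp h0)
  rw [hC] at hp0 ⊢
  exact (IsUnit.mk0 _ (C_ne_zero.mp hp0)).map C

theorem not_X_dvd_frame_e {i j : Fin 2} (h : i ≠ j) : ¬ X i ∣ (frame x).e j := fun hd => by
  have := map_dvd (eval (Pi.single j (2 : ℂ))) hd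
  rw [eval_X, Pi.single_eq_of_ne h, zero_dvd_iff, frame_e] at this
  split_ifs at this <;> norm_num at this

end StandardChart

/-! ### Multiples by Laurent monomials in the coordinates at infinity -/

section Laurent

variable (x : Fin 2 → OnePoint ℂ)

theorem prime_C_X (i : Fin 2) :
    Prime (C (X i) : MvPolynomial (Fin 2) (MvPolynomial (Fin 2) ℂ)) :=
  (prime_C_iff _).mpr X_prime

theorem not_X_dvd_X {i j : Fin 2} (h : i ≠ j) : ¬ X i ∣ (X j : MvPolynomial (Fin 2) ℂ) :=
  fun hd => by
    have := map_dvd (eval (Pi.single j (1 : ℂ))) hd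
    rw [eval_X, eval_X, Pi.single_eq_of_ne h, Pi.single_eq_same, zero_dvd_iff] at this
    exact one_ne_zero this

theorem not_C_X_dvd_C_X_pow {i j : Fin 2} (h : i ≠ j) (n : ℕ) :
    ¬ C (X i) ∣ (C (X j) ^ n : MvPolynomial (Fin 2) (MvPolynomial (Fin 2) ℂ)) := fun hd => by
  have h1 := (prime_C_X i).dvd_of_dvd_pow hd
  rw [C_dvd_iff_dvd_coeff] at h1
  have h2 := h1 0
  rw [coeff_zero_C] at h2
  exact not_X_dvd_X h h2

theorem exists_eq_C_X_pow_mul {q : MvPolynomial (Fin 2) (MvPolynomial (Fin 2) ℂ)} (hq : q ≠ 0)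
    (i : Fin 2) : ∃ (e : ℕ) (q' : MvPolynomial (Fin 2) (MvPolynomial (Fin 2) ℂ)),
      (x i ≠ OnePoint.infty → e = 0) ∧ q = C (X i) ^ e * q' ∧
      (x i = OnePoint.infty → ¬ C (X i) ∣ q') := by
  by_cases h : x i = OnePoint.infty
  · obtain ⟨q', h1, h2⟩ :=
      (FiniteMultiplicity.of_prime_left (prime_C_X i) hq).exists_eq_pow_mul_and_not_dvd
    exact ⟨_, q', fun hn => absurd h hn, h1, fun _ => h2⟩
  · exact ⟨0, q, fun _ => rfl, by rw [pow_zero, one_mul], fun hn => absurd hn h⟩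

/-- A nonzero full symbol is a monomial in the coordinates `sᵢ` at infinity times a full symbol
that is divisible by none of these `sᵢ`. -/
theorem exists_eq_C_prod_mul {q : MvPolynomial (Fin 2) (MvPolynomial (Fin 2) ℂ)} (hq : q ≠ 0) :
    ∃ (e : Fin 2 → ℕ) (q' : MvPolynomial (Fin 2) (MvPolynomial (Fin 2) ℂ)),
      (∀ i, x i ≠ OnePoint.infty → e i = 0) ∧ q = C (∏ i, X i ^ e i) * q' ∧
      ∀ i, x i = OnePoint.infty → ¬ C (X i) ∣ q' := by
  obtain ⟨e₀, q₀, he₀, rfl, h₀⟩ := exists_eq_C_X_pow_mul x hq 0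
  obtain ⟨e₁, q₁, he₁, rfl, h₁⟩ := exists_eq_C_X_pow_mul x (right_ne_zero_of_mul hq) 1
  refine ⟨![e₀, e₁], q₁, fun i => ?_, ?_, fun i => ?_⟩
  · fin_cases i
    · exact he₀
    · exact he₁
  · simp [Fin.prod_univ_two, mul_assoc]
  · fin_cases i
    · exact fun h hd => h₀ h (hd.mul_left _)
    · exact h₁

theorem chart_φ_prod_X_pow (e : Fin 2 → ℕ) :
    (chart x).φ (∏ i, X i ^ e i) = ∏ i, chartCoord x i ^ (e i : ℤ) := by
  rw [chart_φ, map_prod]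
  simp only [map_pow, aeval_X, zpow_natCast]

theorem prod_chartCoord_zpow_add (k l : Fin 2 → ℤ) :
    ∏ i, chartCoord x i ^ (k i + l i) =
      (∏ i, chartCoord x i ^ k i) * ∏ i, chartCoord x i ^ l i := by
  rw [← Finset.prod_mul_distrib]
  exact Finset.prod_congr rfl fun i _ => zpow_add₀ (chartCoord_ne_zero x i) _ _

/-- If the full symbol `p` is divisible by none of the coordinates at infinity, the multiples of
`op p` by Laurent monomials in these coordinates with polynomial coefficients are polynomial
multiples. -/
theorem exists_eq_C_mul_of_op_eq {p q : MvPolynomial (Fin 2) (MvPolynomial (Fin 2) ℂ)}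
    (hp : ∀ i, x i = OnePoint.infty → ¬ C (X i) ∣ p) {k : Fin 2 → ℤ}
    (hk : ∀ i, x i ≠ OnePoint.infty → k i = 0)
    (h : (chart x).op q = mulOp (∏ i, chartCoord x i ^ k i) * (chart x).op p) :
    ∃ b, q = C b * p := by
  have hmul : C (∏ i, X i ^ (-k i).toNat) * q = C (∏ i, X i ^ (k i).toNat) * p := by
    refine (chart x).op_injective ?_
    rw [Chart.op_C_mul, Chart.op_C_mul, h, ← mul_assoc, ← map_mul, chart_φ_prod_X_pow,
      chart_φ_prod_X_pow, ← prod_chartCoord_zpow_add]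
    congr! 5 with i
    omega
  have hneg : ∀ i, (-k i).toNat = 0 := fun i => by
    by_contra hi
    have hinf : x i = OnePoint.infty := by
      by_contra hx
      rw [hk i hx] at hi
      exact hi rfl
    have hpos : (k i).toNat = 0 := by omega
    have hd : C (X i) ∣ C (∏ i, X i ^ (k i).toNat) * p := by
      rw [← hmul]
      exact (map_dvd C ((dvd_pow_self (X i) hi).trans (Finset.dvd_prod_of_mem
        (fun i => (X i : MvPolynomial (Fin 2) ℂ) ^ (-k i).toNat) (Finset.mem_univ i)))).mul_right _
    rcases (prime_C_X i).dvd_or_dvd hd with h1 | h1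
    · rw [map_prod] at h1
      obtain ⟨j, -, hj⟩ := (prime_C_X i).exists_mem_finset_dvd h1
      rw [C_pow] at hj
      rcases eq_or_ne i j with rfl | hij
      · rw [hpos, pow_zero] at hj
        exact (prime_C_X i).not_isUnit (isUnit_of_dvd_one hj)
      · exact not_C_X_dvd_C_X_pow hij _ hj
    · exact hp i hinf h1
  refine ⟨∏ i, X i ^ (k i).toNat, ?_⟩
  rw [← hmul]
  simp [hneg]

/-- The logarithmic derivatives of Laurent monomials in the coordinates at infinity along
`∂/∂tᵢ` and `tᵢ ∂/∂tᵢ` are polynomials in the coordinates. -/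
theorem frame_logDeriv {k : Fin 2 → ℤ} (hk : ∀ i, x i ≠ OnePoint.infty → k i = 0) (i : Fin 2) :
    ∃ b b', (chart x).φ ((frame x).h i) * (chart x).d i (∏ i, chartCoord x i ^ k i) =
        (chart x).φ b * ∏ i, chartCoord x i ^ k i ∧
      (chart x).φ ((frame x).g i) * (chart x).d i (∏ i, chartCoord x i ^ k i) =
        (chart x).φ b' * ∏ i, chartCoord x i ^ k i := by
  have hcoord : ∀ i, (chart x).φ (X i) = chartCoord x i := fun i => aeval_X _ i
  have hd : chartCoord x i * (chart x).d i (∏ i, chartCoord x i ^ k i) =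
      (k i : RatFun) * ∏ i, chartCoord x i ^ k i := by
    have hz : ∀ j, (chart x).d i (chartCoord x j ^ k j) =
        if i = j then (k i : RatFun) * chartCoord x i ^ (k i - 1) else 0 := fun j => by
      rw [← Chart.der_apply, Derivation.leibniz_zpow, Chart.der_apply]
      change _ • _ • chartDer x i _ = _
      rw [chartDer_chartCoord]
      rcases eq_or_ne i j with rfl | hij
      · simp
      · simp [hij]
    have h0 : ∀ i, chartCoord x i ^ k i = chartCoord x i * chartCoord x i ^ (k i - 1) :=
      fun i => by
        rw [← zpow_one_add₀ (chartCoord_ne_zero x i)]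
        congr 1
        ring
    rw [Fin.prod_univ_two, Chart.leibniz, hz, hz]
    fin_cases i
    · simp only [Fin.zero_eta, if_true, zero_ne_one, if_false, h0 0]
      ring
    · simp only [Fin.mk_one, if_true, one_ne_zero, if_false, h0 1]
      ring
  by_cases h : x i = OnePoint.infty
  · refine ⟨C (-(k i : ℂ)) * X i, C (-(k i : ℂ)), ?_, ?_⟩
    · rw [show (frame x).h i = -X i ^ 2 from if_pos h, map_neg, map_pow, map_mul, hcoord,
        chart_φ x (C _), aeval_C, map_neg (algebraMap ℂ RatFun), map_intCast]
      linear_combination -chartCoord x i * hd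
    · rw [show (frame x).g i = -X i from if_pos h, map_neg, hcoord,
        chart_φ x (C _), aeval_C, map_neg (algebraMap ℂ RatFun), map_intCast]
      linear_combination -hd
  · have h0 : (chart x).d i (∏ i, chartCoord x i ^ k i) = 0 := by
      rw [hk i h, Int.cast_zero, zero_mul] at hd
      exact (mul_eq_zero.mp hd).resolve_left (chartCoord_ne_zero x i)
    exact ⟨0, 0, by rw [h0]; simp, by rw [h0]; simp⟩

end Laurent

/-! ### The principal symbols of the system in a chart -/

section ChartIdeal

variable (A : Fin 4 → ℂ) (x : Fin 2 → OnePoint ℂ)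

theorem not_C_X_dvd_of_sub_mem {p : MvPolynomial (Fin 2) (MvPolynomial (Fin 2) ℂ)}
    (hp : p - (frame x).sym₁ ∈ degLT _ 2) (i : Fin 2) : ¬ C (X i) ∣ p := fun ⟨r, hr⟩ => by
  have hom := ((frame x).hasSymbol_P₁ 0).isHomogeneous
  have h := homogeneousComponent_eq_zero_of_mem_degLT hp
  rw [map_sub, homogeneousComponent_eq_self hom, sub_eq_zero, hr, homogeneousComponent_C_mul] at h
  obtain ⟨j, hj⟩ := exists_ne i
  have := congrArg (eval (Pi.single j 1)) h
  rw [Chart.Frame.eval_single_sym₁, map_mul, eval_C] at this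
  exact not_X_dvd_frame_e x hj.symm ⟨_, this.symm⟩

/-- In every chart, the principal symbols of the operators in the left ideal of the system lie in
the ideal generated by the principal symbol `sym₁` of `P₁` and the principal symbol `σ` of a
multiple of `P₂` by a Laurent monomial in the coordinates at infinity. -/
theorem exists_symbol_chartIdeal :
    ∃ (e : Fin 2 → ℕ) (σ : MvPolynomial (Fin 2) (MvPolynomial (Fin 2) ℂ)),
      (∀ i, x i ≠ OnePoint.infty → e i = 0) ∧ (frame x).sym₂ = C (∏ i, X i ^ e i) * σ ∧
      ∀ Q ∈ chartIdeal (Z₂ A) x, ∀ p, (Q : Module.End ℂ RatFun) = opOfSymbol x p →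
        ∃ a b, homogeneousComponent p.totalDegree p = a * (frame x).sym₁ + b * σ := by
  classical
  obtain ⟨p₁, hp₁, hom₁, hsub₁⟩ := (frame x).hasSymbol_P₁ A
  obtain ⟨q, hq, hom₂, hsub₂⟩ := (frame x).hasSymbol_P₂ A
  have htop : homogeneousComponent 3 q = (frame x).sym₂ := by
    have := homogeneousComponent_eq_zero_of_mem_degLT hsub₂
    rwa [map_sub, homogeneousComponent_eq_self hom₂, sub_eq_zero] at this
  have hq0 : q ≠ 0 := by
    rintro rfl
    rw [map_zero] at htop
    exact (frame x).sym₂_ne_zero htop.symm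
  obtain ⟨e, q', he, hqq', hdvd⟩ := exists_eq_C_prod_mul x hq0
  have hm0 : (∏ i, X i ^ e i : MvPolynomial (Fin 2) ℂ) ≠ 0 :=
    Finset.prod_ne_zero_iff.mpr fun i _ => pow_ne_zero _ (X_ne_zero i)
  have hσ : (frame x).sym₂ = C (∏ i, X i ^ e i) * homogeneousComponent 3 q' := by
    rw [← htop, hqq', homogeneousComponent_C_mul]
  refine ⟨e, homogeneousComponent 3 q', he, hσ, ?_⟩
  have hq'4 : q' ∈ degLT _ 4 := fun α hα => by
    have := Chart.mem_degLT_of_sub_mem hom₂ hsub₂ α hα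
    rw [hqq', coeff_C_mul] at this
    exact (mul_eq_zero.mp this).resolve_left hm0
  have hsym : (chart x).HasSymbol ((chart x).op q') 3 (homogeneousComponent 3 q') :=
    ⟨q', rfl, homogeneousComponent_isHomogeneous _ _, sub_homogeneousComponent_mem_degLT hq'4⟩
  -- The operator with full symbol `q'` is the multiple of `P₂` by a Laurent monomial.
  let l : Fin 2 → ℤ := fun i => (if x i = OnePoint.infty then 1 else 0) - e i
  have hl : ∀ i, x i ≠ OnePoint.infty → l i = 0 := fun i hi => by simp [l, hi, he i hi]
  have hden : (chart x).φ ((frame x).den 0 * (frame x).den 1) =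
      ∏ i, chartCoord x i ^ ((if x i = OnePoint.infty then 1 else 0 : ℕ) : ℤ) := by
    have h : ∀ i, (frame x).den i = X i ^ (if x i = OnePoint.infty then 1 else 0) := fun i => by
      by_cases hi : x i = OnePoint.infty
      · rw [show (frame x).den i = X i from if_pos hi, if_pos hi, pow_one]
      · rw [show (frame x).den i = 1 from if_neg hi, if_neg hi, pow_zero]
    rw [← chart_φ_prod_X_pow, Fin.prod_univ_two, h, h]
  have hq' : (chart x).op q' = mulOp (∏ i, chartCoord x i ^ l i) * P₂ A := by
    have h1 : mulOp (∏ i, chartCoord x i ^ (-(e i : ℤ))) * mulOp ((chart x).φ (∏ i, X i ^ e i)) =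
        1 := by
      rw [← map_mul, chart_φ_prod_X_pow, ← prod_chartCoord_zpow_add]
      simp
    rw [hqq', Chart.op_C_mul] at hq
    rw [← one_mul ((chart x).op q'), ← h1, mul_assoc, hq, ← mul_assoc, ← map_mul, hden,
      ← prod_chartCoord_zpow_add]
    congr! 5 with i
    simp only [l]
    push_cast
    ring
  obtain ⟨P₁', hP₁', hconj⟩ := (frame x).exists_hasSymbol_conj A (frame_logDeriv x hl)
  have hcomm : (chart x).op q' * P₁ A = P₁' * (chart x).op q' := by
    rw [hq', mul_assoc, ← P₁_mul_P₂, ← mul_assoc, hconj, mul_assoc]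
  have hrel : IsRelPrime (frame x).sym₁ (homogeneousComponent 3 q') :=
    ((frame x).isRelPrime_sym (isRelPrime_frame_e x)).of_dvd_right ⟨_, by rw [hσ, mul_comm]⟩
  have hσ0 : homogeneousComponent 3 q' ≠ 0 := fun h =>
    (frame x).sym₂_ne_zero (by rw [hσ, h, mul_zero])
  -- The left ideal is generated by `P₁` and this multiple.
  have hgen : ∀ Q ∈ chartIdeal (Z₂ A) x, ∃ u v : chartDiffOp x,
      (Q : Module.End ℂ RatFun) = u * P₁ A + v * (chart x).op q' := by
    intro Q hQ
    rw [chartIdeal] at hQ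
    induction hQ using Submodule.span_induction with
    | mem Q hQ =>
      obtain ⟨j, k, hk, hQ⟩ := hQ
      obtain ⟨r, hr⟩ := (mem_chartDiffOp_iff x Q).mp Q.2
      have hC : ∀ b, (chart x).op (C b) ∈ chartDiffOp x := fun b =>
        (mem_chartDiffOp_iff x _).mpr ⟨_, rfl⟩
      fin_cases j
      · have h : (chart x).op r = mulOp (∏ i, chartCoord x i ^ k i) * (chart x).op p₁ := by
          rw [hr, hQ, hp₁]
          rfl
        obtain ⟨b, hb⟩ := exists_eq_C_mul_of_op_eq x
          (fun i _ => not_C_X_dvd_of_sub_mem x hsub₁ i) hk h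
        refine ⟨⟨_, hC b⟩, 0, ?_⟩
        rw [← hr, hb, Chart.op_C_mul, hp₁, ← Chart.op_C, ZeroMemClass.coe_zero, zero_mul, add_zero]
      · have h : (chart x).op r =
            mulOp (∏ i, chartCoord x i ^ (k i - l i)) * (chart x).op q' := by
          rw [hr, hQ, hq', ← mul_assoc, ← map_mul, ← prod_chartCoord_zpow_add]
          simp only [sub_add_cancel]
          rfl
        obtain ⟨b, hb⟩ := exists_eq_C_mul_of_op_eq x hdvd
          (fun i hi => by rw [hk i hi, hl i hi, sub_zero]) h
        refine ⟨0, ⟨_, hC b⟩, ?_⟩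
        rw [← hr, hb, Chart.op_C_mul, ← Chart.op_C, ZeroMemClass.coe_zero, zero_mul, zero_add]
    | zero => exact ⟨0, 0, by simp⟩
    | add Q R _ _ hQ hR =>
      obtain ⟨u, v, hQ⟩ := hQ
      obtain ⟨u', v', hR⟩ := hR
      refine ⟨u + u', v + v', ?_⟩
      simp only [Subring.coe_add, hQ, hR, add_mul]
      abel
    | smul T Q _ hQ =>
      obtain ⟨u, v, hQ⟩ := hQ
      refine ⟨T * u, T * v, ?_⟩
      simp only [smul_eq_mul, Subring.coe_mul, hQ, mul_add, mul_assoc]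
  intro Q hQ p hp
  obtain ⟨⟨U, hU⟩, ⟨V, hV⟩, hQ⟩ := hgen Q hQ
  obtain ⟨u, rfl⟩ := (mem_chartDiffOp_iff x U).mp hU
  obtain ⟨v, rfl⟩ := (mem_chartDiffOp_iff x V).mp hV
  obtain ⟨a, -, b, -, h⟩ := Chart.exists_homogeneousComponent_eq ((frame x).hasSymbol_P₁ A) hP₁'
    hsym hcomm (frame x).sym₁_ne_zero hσ0 hrel (u.totalDegree + v.totalDegree + 2)
    u (degLT_mono (by omega) (mem_degLT_totalDegree u))
    v (degLT_mono (by omega) (mem_degLT_totalDegree v)) p (by rw [← hQ, hp, opOfSymbol_eq])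
    p.totalDegree (mem_degLT_totalDegree p)
  exact ⟨a, b, h⟩

end ChartIdeal

/-! ### The singular locus -/

section SingularLocus

variable {A : Fin 4 → ℂ} {x : Fin 2 → OnePoint ℂ}

/-- Evaluation of symbols at the covector `ξ` over the point `x`. -/
def symbolEval (x : Fin 2 → OnePoint ℂ) (ξ : Fin 2 → ℂ) :
    MvPolynomial (Fin 2) (MvPolynomial (Fin 2) ℂ) →+* ℂ :=
  (eval ξ).comp (map (eval (chartValue x)))

theorem symbolEval_C (ξ : Fin 2 → ℂ) (b : MvPolynomial (Fin 2) ℂ) :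
    symbolEval x ξ (C b) = eval (chartValue x) b := by
  rw [symbolEval, RingHom.comp_apply, map_C, eval_C]

theorem symbolEval_X (ξ : Fin 2 → ℂ) (i : Fin 2) : symbolEval x ξ (X i) = ξ i := by
  rw [symbolEval, RingHom.comp_apply, map_X, eval_X]

theorem symbolEval_single (i : Fin 2) (p : MvPolynomial (Fin 2) (MvPolynomial (Fin 2) ℂ)) :
    symbolEval x (Pi.single i 1) p = eval (chartValue x) (eval (Pi.single i 1) p) := by
  have h : symbolEval x (Pi.single i 1) = (eval (chartValue x)).comp (eval (Pi.single i 1)) := by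
    refine ringHom_ext (fun b => ?_) fun j => ?_
    · rw [symbolEval_C, RingHom.comp_apply, eval_C]
    · rw [symbolEval_X, RingHom.comp_apply, eval_X]
      rcases eq_or_ne j i with rfl | hij
      · simp
      · simp [hij]
  rw [h, RingHom.comp_apply]

theorem mem_charFibre_of_symbolEval_eq_zero {ξ : Fin 2 → ℂ}
    {σ : MvPolynomial (Fin 2) (MvPolynomial (Fin 2) ℂ)}
    (h : ∀ Q ∈ chartIdeal (Z₂ A) x, ∀ p, (Q : Module.End ℂ RatFun) = opOfSymbol x p →
        ∃ a b, homogeneousComponent p.totalDegree p = a * (frame x).sym₁ + b * σ)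
    (h₁ : symbolEval x ξ (frame x).sym₁ = 0) (h₂ : symbolEval x ξ σ = 0) :
    ξ ∈ charFibre (Z₂ A) x := by
  intro Q hQ p hp
  obtain ⟨a, b, hab⟩ := h Q hQ p hp
  change symbolEval x ξ _ = 0
  rw [hab, map_add, map_mul, map_mul, h₁, h₂, mul_zero, mul_zero, add_zero]

/-- Along `tᵢ = ±1` and `tᵢ = ∞` the coefficient of `ξᵢ²` in the symbol of `P₁` vanishes, and the
symbol of (a multiple of) `P₂` is divisible by `ξ₁ ξ₂` everywhere, so the `i`-th coordinate covector
belongs to the characteristic variety. -/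
theorem single_mem_charFibre (A : Fin 4 → ℂ) {i : Fin 2}
    (hi : x i = ((1 : ℂ) : OnePoint ℂ) ∨ x i = ((-1 : ℂ) : OnePoint ℂ) ∨ x i = OnePoint.infty) :
    Pi.single i 1 ∈ charFibre (Z₂ A) x := by
  obtain ⟨e, σ, -, hσ, h⟩ := exists_symbol_chartIdeal A x
  refine mem_charFibre_of_symbolEval_eq_zero h ?_ ?_
  · rw [symbolEval_single, Chart.Frame.eval_single_sym₁, frame_e]
    rcases hi with hi | hi | hi
    · rw [if_neg (by rw [hi]; exact OnePoint.coe_ne_infty _)]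
      simp [chartValue, hi]
    · rw [if_neg (by rw [hi]; exact OnePoint.coe_ne_infty _)]
      simp [chartValue, hi]
    · rw [if_pos hi]
      simp [chartValue, hi]
  · have h0 := congrArg (eval (Pi.single i 1)) hσ
    have hz : eval (Pi.single i 1) (frame x).sym₂ = 0 := by
      fin_cases i <;> simp [Chart.Frame.sym₂]
    rw [hz, map_mul, eval_C, eq_comm, mul_eq_zero] at h0
    rw [symbolEval_single, h0.resolve_left, map_zero]
    exact Finset.prod_ne_zero_iff.mpr fun i _ => pow_ne_zero _ (X_ne_zero i)

theorem frame_apply_of_ne_infty {i : Fin 2} (hi : x i ≠ OnePoint.infty) :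
    (frame x).h i = 1 ∧ (frame x).g i = X i ∧ (frame x).num i = X i ∧ (frame x).den i = 1 :=
  ⟨if_neg hi, if_neg hi, if_neg hi, if_neg hi⟩

/-- On the diagonal the symbol of `P₂` vanishes and that of `P₁` is a multiple of
`(ξ₁ + ξ₂)²`. -/
theorem mem_charFibre_of_eq (A : Fin 4 → ℂ) (hinf : ∀ i, x i ≠ OnePoint.infty) (h : x 0 = x 1) :
    ![1, -1] ∈ charFibre (Z₂ A) x := by
  obtain ⟨e, σ, he, hσ, h'⟩ := exists_symbol_chartIdeal A x
  have hv : chartValue x 0 = chartValue x 1 := by rw [chartValue, chartValue, h]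
  obtain ⟨h0, g0, n0, d0⟩ := frame_apply_of_ne_infty (hinf 0)
  obtain ⟨h1, g1, n1, d1⟩ := frame_apply_of_ne_infty (hinf 1)
  have hσ' : σ = (frame x).sym₂ := by
    rw [hσ]
    simp [fun i => he i (hinf i)]
  refine mem_charFibre_of_symbolEval_eq_zero h' ?_ ?_
  · simp only [Chart.Frame.sym₁, Chart.Frame.e, map_add, map_mul, map_pow, symbolEval_C,
      symbolEval_X, map_sub, eval_X, h0, h1, g0, g1, map_one, hv, map_ofNat]
    simp
    ring
  · rw [hσ', Chart.Frame.sym₂, map_mul, symbolEval_C, Chart.Frame.diff, n0, n1, d0, d1]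
    simp [hv]

theorem Chart.HasSymbol.totalDegree_eq {B : Type*} [CommRing B] {c : Chart B} {n : ℕ}
    {p σ : MvPolynomial (Fin 2) B} (h : c.HasSymbol (c.op p) n σ) (hσ : σ ≠ 0) :
    p.totalDegree = n ∧ homogeneousComponent n p = σ := by
  obtain ⟨q, hq, hom, hsub⟩ := h
  obtain rfl := c.op_injective hq
  have htop : homogeneousComponent n q = σ := by
    have := homogeneousComponent_eq_zero_of_mem_degLT hsub
    rwa [map_sub, homogeneousComponent_eq_self hom, sub_eq_zero] at this
  refine ⟨le_antisymm (totalDegree_le_of_mem_degLT (Chart.mem_degLT_of_sub_mem hom hsub)) ?_, htop⟩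
  by_contra hlt
  rw [homogeneousComponent_eq_zero _ _ (not_le.mp hlt)] at htop
  exact hσ htop.symm

theorem symbolEval_eq_zero_of_mem_charFibre {ξ : Fin 2 → ℂ} (hξ : ξ ∈ charFibre (Z₂ A) x)
    (j : Fin 2) {n : ℕ} {σ : MvPolynomial (Fin 2) (MvPolynomial (Fin 2) ℂ)}
    (h : (chart x).HasSymbol (Z₂ A j) n σ) (hσ : σ ≠ 0) : symbolEval x ξ σ = 0 := by
  obtain ⟨p, hp, -, -⟩ := id h
  rw [← hp] at h
  obtain ⟨hdeg, htop⟩ := h.totalDegree_eq hσ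
  have hmem : Z₂ A j ∈ chartDiffOp x := (mem_chartDiffOp_iff x _).mpr ⟨p, hp⟩
  have := hξ ⟨_, hmem⟩ (Ideal.subset_span ⟨j, 0, fun _ _ => rfl, by simp⟩) p hp.symm
  rw [principalSymbolAt, hdeg, htop] at this
  exact this

/-- Away from the singular locus the symbols of `P₁` and `P₂` have no common zero. -/
theorem eq_zero_of_mem_charFibre (hinf : ∀ i, x i ≠ OnePoint.infty)
    (hone : ∀ i, x i ≠ ((1 : ℂ) : OnePoint ℂ) ∧ x i ≠ ((-1 : ℂ) : OnePoint ℂ)) (hne : x 0 ≠ x 1)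
    {ξ : Fin 2 → ℂ} (hξ : ξ ∈ charFibre (Z₂ A) x) : ξ = 0 := by
  have hval : ∀ i, x i = (chartValue x i : OnePoint ℂ) := fun i => by
    obtain ⟨z, hz⟩ := OnePoint.ne_infty_iff_exists.mp (hinf i)
    rw [chartValue, ← hz]
    rfl
  obtain ⟨h0, g0, n0, d0⟩ := frame_apply_of_ne_infty (hinf 0)
  obtain ⟨h1, g1, n1, d1⟩ := frame_apply_of_ne_infty (hinf 1)
  have hs₂ : (chart x).HasSymbol (P₂ A) 3 (frame x).sym₂ := by
    have := (frame x).hasSymbol_P₂ A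
    rwa [d0, d1, mul_one, map_one, map_one, one_mul] at this
  have e₁ := symbolEval_eq_zero_of_mem_charFibre hξ 0 ((frame x).hasSymbol_P₁ A)
    (frame x).sym₁_ne_zero
  have e₂ := symbolEval_eq_zero_of_mem_charFibre hξ 1 hs₂ (frame x).sym₂_ne_zero
  have e₃ := congrArg (symbolEval x ξ) (frame x).C_mul_X_sq_mul_X_sq
  rw [map_sub, map_mul _ _ (frame x).sym₁, e₁, map_mul _ _ (frame x).sym₂, e₂] at e₃
  simp only [Chart.Frame.diff, Chart.Frame.sym₁, Chart.Frame.e, map_mul, map_pow, map_sub, map_add,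
    symbolEval_C, symbolEval_X, h0, h1, g0, g1, n0, n1, d0, d1, map_one, eval_X, map_ofNat] at e₁ e₃
  rw [hval 0, hval 1] at hne
  have hsub : chartValue x 0 - chartValue x 1 ≠ 0 := fun h => hne (by rw [sub_eq_zero.mp h])
  have hsq : ∀ i, 1 - chartValue x i ^ 2 ≠ 0 := fun i h => by
    have h' : (1 - chartValue x i) * (1 + chartValue x i) = 0 := by linear_combination h
    rcases mul_eq_zero.mp h' with h' | h'
    · exact (hone i).1 (by rw [hval i, ← sub_eq_zero.mp h'])
    · exact (hone i).2 (by rw [hval i, eq_neg_of_add_eq_zero_right h'])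
  have h01 : ξ 0 = 0 ∨ ξ 1 = 0 := by
    have : (chartValue x 0 - chartValue x 1) ^ 3 * (ξ 0 * ξ 1) ^ 2 = 0 := by
      linear_combination e₃ / 2
    exact mul_eq_zero.mp (pow_eq_zero_iff two_ne_zero |>.mp
      ((mul_eq_zero.mp this).resolve_left (pow_ne_zero 3 hsub)))
  have hz : ξ 0 = 0 ∧ ξ 1 = 0 := by
    rcases h01 with h | h
    · refine ⟨h, ?_⟩
      have : (1 - chartValue x 1 ^ 2) * ξ 1 ^ 2 = 0 := by
        rw [h] at e₁
        linear_combination e₁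
      exact pow_eq_zero_iff two_ne_zero |>.mp ((mul_eq_zero.mp this).resolve_left (hsq 1))
    · refine ⟨?_, h⟩
      have : (1 - chartValue x 0 ^ 2) * ξ 0 ^ 2 = 0 := by
        rw [h] at e₁
        linear_combination e₁
      exact pow_eq_zero_iff two_ne_zero |>.mp ((mul_eq_zero.mp this).resolve_left (hsq 0))
  ext i
  fin_cases i
  · exact hz.1
  · exact hz.2

theorem singularLocus_Z₂ (A : Fin 4 → ℂ) :
    singularLocus (Z₂ A) =
      {x | (∃ i, x i = ((1 : ℂ) : OnePoint ℂ) ∨ x i = ((-1 : ℂ) : OnePoint ℂ) ∨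
        x i = OnePoint.infty) ∨ x 0 = x 1} := by
  ext x
  constructor
  · rintro ⟨ξ, hξ, hne⟩
    by_contra hx
    simp only [Set.mem_ofPred_eq, not_or, not_exists] at hx
    exact hne (eq_zero_of_mem_charFibre (fun i => (hx.1 i).2.2)
      (fun i => ⟨(hx.1 i).1, (hx.1 i).2.1⟩) hx.2 hξ)
  · intro hx
    by_cases hi : ∃ i, x i = ((1 : ℂ) : OnePoint ℂ) ∨ x i = ((-1 : ℂ) : OnePoint ℂ) ∨
        x i = OnePoint.infty
    · obtain ⟨i, hi⟩ := hi
      exact ⟨_, single_mem_charFibre A hi, by simp⟩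
    · have h01 := Or.resolve_left hx hi
      push Not at hi
      refine ⟨_, mem_charFibre_of_eq A (fun i => (hi i).2.2) h01, fun h => ?_⟩
      simpa using congrFun h 0

end SingularLocus

/-! ### The rank -/

section Rank

/-- The chart with coefficients in `ℂ(t₁, t₂)`. -/
def ratChart : Chart RatFun where
  φ := RingHom.id RatFun
  d := pd
  s := tvar
  δ i := pd i
  inj := Function.injective_id
  leibniz := pd_mul
  comm := by
    ext f
    exact pd_pd_comm f
  d_s := pd_tvar
  φ_δ _ _ := rfl

/-- In `ratChart` the coordinates are `t₁, t₂` themselves. -/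
def ratFrame : ratChart.Frame where
  h _ := 1
  g := tvar
  num := tvar
  den _ := 1
  h_d i := by
    rw [map_one, map_one, one_mul]
    rfl
  g_eq i := by
    rw [map_one, mul_one]
    rfl
  den_eq i := by
    rw [map_one, one_mul]
    rfl
  den_ne_zero _ := one_ne_zero
  const z := ⟨_, rfl⟩

theorem mem_ratDiffOp_iff (T : Module.End ℂ RatFun) :
    T ∈ RatDiffOp ↔ ∃ p, ratChart.op p = T :=
  ratChart.mem_closure_iff T

variable (A : Fin 4 → ℂ)

theorem hasSymbol_P₂_ratChart : ratChart.HasSymbol (P₂ A) 3 ratFrame.sym₂ := by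
  have := ratFrame.hasSymbol_P₂ A
  rwa [show ratFrame.den 0 * ratFrame.den 1 = 1 from mul_one 1, map_one, map_one, one_mul] at this

theorem exists_eq_add_of_mem_ratIdeal {Q : RatDiffOp} (hQ : Q ∈ ratIdeal (Z₂ A)) :
    ∃ u v : RatDiffOp, (Q : Module.End ℂ RatFun) = u * P₁ A + v * P₂ A := by
  rw [ratIdeal] at hQ
  induction hQ using Submodule.span_induction with
  | mem Q hQ =>
    obtain ⟨j, hQ⟩ := hQ
    fin_cases j
    · exact ⟨1, 0, by rw [hQ]; simp [Z₂]⟩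
    · exact ⟨0, 1, by rw [hQ]; simp [Z₂]⟩
  | zero => exact ⟨0, 0, by simp⟩
  | add Q R _ _ hQ hR =>
    obtain ⟨u, v, hQ⟩ := hQ
    obtain ⟨u', v', hR⟩ := hR
    refine ⟨u + u', v + v', ?_⟩
    simp only [Subring.coe_add, hQ, hR, add_mul]
    abel
  | smul T Q _ hQ =>
    obtain ⟨u, v, hQ⟩ := hQ
    refine ⟨T * u, T * v, ?_⟩
    simp only [smul_eq_mul, Subring.coe_mul, hQ, mul_add, mul_assoc]

theorem exists_homogeneousComponent_of_mem_ratIdeal {Q : RatDiffOp} (hQ : Q ∈ ratIdeal (Z₂ A))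
    {q : MvPolynomial (Fin 2) RatFun} (hq : ratChart.op q = Q) {n : ℕ}
    (hn : q ∈ degLT RatFun (n + 1)) :
    ∃ a ∈ degLT RatFun (n - 1), ∃ b ∈ degLT RatFun (n - 2),
      homogeneousComponent n q = a * ratFrame.sym₁ + b * ratFrame.sym₂ := by
  obtain ⟨⟨U, hU⟩, ⟨V, hV⟩, hQ⟩ := exists_eq_add_of_mem_ratIdeal A hQ
  obtain ⟨u, rfl⟩ := (mem_ratDiffOp_iff U).mp hU
  obtain ⟨v, rfl⟩ := (mem_ratDiffOp_iff V).mp hV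
  have hrel : IsRelPrime (ratFrame.e 0) (ratFrame.e 1) :=
    (IsUnit.mk0 _ (ratFrame.e_ne_zero 0)).isRelPrime_left
  exact Chart.exists_homogeneousComponent_eq (ratFrame.hasSymbol_P₁ A) (ratFrame.hasSymbol_P₁ A)
    (hasSymbol_P₂_ratChart A) (P₁_mul_P₂ A).symm ratFrame.sym₁_ne_zero ratFrame.sym₂_ne_zero
    (ratFrame.isRelPrime_sym hrel) (u.totalDegree + v.totalDegree + 2)
    u (degLT_mono (by omega) (mem_degLT_totalDegree u))
    v (degLT_mono (by omega) (mem_degLT_totalDegree v)) q (by rw [hq, hQ]) n hn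

/-- The full symbols `1, ξ₁, ξ₂, ξ₁², ξ₁ξ₂, ξ₁²ξ₂` of a basis of the quotient by the left ideal. -/
def basisSymbol : Fin 6 → MvPolynomial (Fin 2) RatFun :=
  ![1, X 0, X 1, X 0 ^ 2, X 0 * X 1, X 0 ^ 2 * X 1]

theorem isHomogeneous_X_pow_mul_X_pow {B : Type*} [CommRing B] (i j : ℕ) :
    (X 0 ^ i * X 1 ^ j : MvPolynomial (Fin 2) B).IsHomogeneous (i + j) := by
  have := ((isHomogeneous_X B (0 : Fin 2)).pow i).mul ((isHomogeneous_X B (1 : Fin 2)).pow j)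
  simpa using this

theorem C_mul_mem_degLT {B : Type*} [CommRing B] (b : B) {i j n : ℕ} (h : i + j < n) :
    C b * (X 0 ^ i * X 1 ^ j) ∈ degLT B n := by
  rw [← smul_eq_C_mul]
  exact Submodule.smul_mem _ _
    (degLT_mono h (mem_degLT_of_isHomogeneous (isHomogeneous_X_pow_mul_X_pow i j)))

theorem isHomogeneous_C_mul_X_pow {B : Type*} [CommRing B] (b : B) (i j : ℕ) :
    (C b * (X 0 ^ i * X 1 ^ j) : MvPolynomial (Fin 2) B).IsHomogeneous (i + j) := by
  simpa using (isHomogeneous_C _ b).mul (isHomogeneous_X_pow_mul_X_pow i j)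

/-- The symbol of `P₁` is the product of two linear forms in `ξ`; these are their zeros. -/
theorem eval_ratFrame_sym₁ :
    eval ![1 - tvar 1, -(1 - tvar 0)] ratFrame.sym₁ = 0 ∧
      eval ![1 + tvar 1, -(1 + tvar 0)] ratFrame.sym₁ = 0 := by
  constructor <;>
  · simp [Chart.Frame.sym₁, Chart.Frame.e, ratFrame]
    ring

theorem one_sub_tvar_ne_zero (i : Fin 2) : 1 - tvar i ≠ 0 := fun h =>
  one_sub_tvar_sq_ne_zero i (by linear_combination (1 + tvar i) * h)

theorem one_add_tvar_ne_zero (i : Fin 2) : 1 + tvar i ≠ 0 := fun h =>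
  one_sub_tvar_sq_ne_zero i (by linear_combination (1 - tvar i) * h)

theorem eq_zero_of_cubic {f : RatFun} {a b : MvPolynomial (Fin 2) RatFun} (hb : b ∈ degLT RatFun 1)
    (h : C f * (X 0 ^ 2 * X 1 ^ 1) = a * ratFrame.sym₁ + b * ratFrame.sym₂) : f = 0 := by
  obtain ⟨h1, h2⟩ := eval_ratFrame_sym₁
  have hbC : b = C (coeff 0 b) := by
    rw [← totalDegree_eq_zero_iff_eq_C]
    exact Nat.le_zero.mp (totalDegree_le_of_mem_degLT hb)
  generalize coeff 0 b = β at hbC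
  subst hbC
  have e1 := congrArg (eval ![1 - tvar 1, -(1 - tvar 0)]) h
  have e2 := congrArg (eval ![1 + tvar 1, -(1 + tvar 0)]) h
  rw [map_add, map_mul _ a, h1] at e1
  rw [map_add, map_mul _ a, h2] at e2
  simp [Chart.Frame.sym₂, Chart.Frame.e, Chart.Frame.diff, ratFrame] at e1 e2
  have hs := sub_ne_zero.mpr tvar_zero_ne_tvar_one
  have f1 : f = 2 * β * (tvar 0 - tvar 1) ^ 2 * (1 - tvar 0) := by
    refine mul_left_cancel₀ (mul_ne_zero (pow_ne_zero 2 (one_sub_tvar_ne_zero 1))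
      (one_sub_tvar_ne_zero 0)) ?_
    linear_combination -e1
  have f2 : f = -(2 * β * (tvar 0 - tvar 1) ^ 2 * (1 + tvar 0)) := by
    refine mul_left_cancel₀ (mul_ne_zero (pow_ne_zero 2 (one_add_tvar_ne_zero 1))
      (one_add_tvar_ne_zero 0)) ?_
    linear_combination -e2
  have hβ : β = 0 := by
    refine (mul_eq_zero.mp (?_ : β * (tvar 0 - tvar 1) ^ 2 = 0)).resolve_right (pow_ne_zero 2 hs)
    linear_combination (f2 - f1) / 4
  rw [f1, hβ]
  ring

theorem eq_zero_of_quadratic {f g : RatFun} {a : MvPolynomial (Fin 2) RatFun}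
    (h : C f * (X 0 ^ 2 * X 1 ^ 0) + C g * (X 0 ^ 1 * X 1 ^ 1) = a * ratFrame.sym₁) :
    f = 0 ∧ g = 0 := by
  obtain ⟨h1, h2⟩ := eval_ratFrame_sym₁
  have e1 := congrArg (eval ![1 - tvar 1, -(1 - tvar 0)]) h
  have e2 := congrArg (eval ![1 + tvar 1, -(1 + tvar 0)]) h
  rw [map_mul _ a, h1] at e1
  rw [map_mul _ a, h2] at e2
  simp at e1 e2
  have hs := sub_ne_zero.mpr tvar_zero_ne_tvar_one
  have f1 : f * (1 - tvar 1) = g * (1 - tvar 0) := by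
    refine mul_left_cancel₀ (one_sub_tvar_ne_zero 1) ?_
    linear_combination e1
  have f2 : f * (1 + tvar 1) = g * (1 + tvar 0) := by
    refine mul_left_cancel₀ (one_add_tvar_ne_zero 1) ?_
    linear_combination e2
  constructor
  · refine (mul_eq_zero.mp (?_ : f * (tvar 0 - tvar 1) = 0)).resolve_right hs
    linear_combination ((1 + tvar 0) * f1 - (1 - tvar 0) * f2) / 2
  · refine (mul_eq_zero.mp (?_ : g * (tvar 0 - tvar 1) = 0)).resolve_right hs
    linear_combination ((1 + tvar 1) * f1 - (1 - tvar 1) * f2) / 2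

/-- The operators with full symbols `basisSymbol` are independent modulo the left ideal: in the
degrees `0, 1, 2, 3`, no nontrivial combination lies in the ideal `(sym₁, sym₂)`. -/
theorem eq_zero_of_sum_mem_ratIdeal {Q : RatDiffOp} (hQ : Q ∈ ratIdeal (Z₂ A))
    {g : Fin 6 → RatFun}
    (h : ratChart.op (∑ i, C (g i) * basisSymbol i) = Q) : g = 0 := by
  have hsum : ∑ i, C (g i) * basisSymbol i =
      C (g 5) * (X 0 ^ 2 * X 1 ^ 1) + (C (g 3) * (X 0 ^ 2 * X 1 ^ 0) + C (g 4) * (X 0 ^ 1 * X 1 ^ 1))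
      + (C (g 1) * (X 0 ^ 1 * X 1 ^ 0) + C (g 2) * (X 0 ^ 0 * X 1 ^ 1))
      + C (g 0) * (X 0 ^ 0 * X 1 ^ 0) := by
    simp [basisSymbol, Fin.sum_univ_six]
    ring
  rw [hsum] at h
  have key := fun {n : ℕ} => exists_homogeneousComponent_of_mem_ratIdeal A hQ h (n := n)
  have htop : ∀ {n : ℕ} {σ r : MvPolynomial (Fin 2) RatFun}, σ.IsHomogeneous n →
      r ∈ degLT RatFun n → homogeneousComponent n (σ + r) = σ := fun hσ hr => by
    rw [map_add, homogeneousComponent_eq_self hσ, homogeneousComponent_eq_zero_of_mem_degLT hr,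
      add_zero]
  have hom := isHomogeneous_C_mul_X_pow (B := RatFun)
  have mem := @C_mul_mem_degLT RatFun _
  have h5 : g 5 = 0 := by
    have hr : (C (g 3) * (X 0 ^ 2 * X 1 ^ 0) + C (g 4) * (X 0 ^ 1 * X 1 ^ 1)) +
        ((C (g 1) * (X 0 ^ 1 * X 1 ^ 0) + C (g 2) * (X 0 ^ 0 * X 1 ^ 1))
        + C (g 0) * (X 0 ^ 0 * X 1 ^ 0)) ∈ degLT RatFun 3 :=
      add_mem (add_mem (mem _ (by norm_num)) (mem _ (by norm_num)))
        (add_mem (add_mem (mem _ (by norm_num)) (mem _ (by norm_num))) (mem _ (by norm_num)))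
    rw [add_assoc, add_assoc] at key
    obtain ⟨a, -, b, hb, e⟩ := key (n := 3)
      (add_mem (mem _ (by norm_num)) (degLT_mono (by norm_num) hr))
    rw [htop (hom (g 5) 2 1) hr] at e
    exact eq_zero_of_cubic hb e
  rw [h5, C_0, zero_mul, zero_add] at key
  have h34 : g 3 = 0 ∧ g 4 = 0 := by
    have hr : (C (g 1) * (X 0 ^ 1 * X 1 ^ 0) + C (g 2) * (X 0 ^ 0 * X 1 ^ 1))
        + C (g 0) * (X 0 ^ 0 * X 1 ^ 0) ∈ degLT RatFun 2 :=
      add_mem (add_mem (mem _ (by norm_num)) (mem _ (by norm_num))) (mem _ (by norm_num))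
    rw [add_assoc] at key
    obtain ⟨a, -, b, hb, e⟩ := key (n := 2) (add_mem (add_mem (mem _ (by norm_num))
      (mem _ (by norm_num))) (degLT_mono (by norm_num) hr))
    rw [htop ((hom (g 3) 2 0).add (hom (g 4) 1 1)) hr, eq_zero_of_mem_degLT_zero hb, zero_mul,
      add_zero] at e
    exact eq_zero_of_quadratic e
  rw [h34.1, h34.2, C_0, zero_mul, zero_mul, zero_add, zero_add] at key
  have h12 : g 1 = 0 ∧ g 2 = 0 := by
    obtain ⟨a, ha, b, hb, e⟩ := key (n := 1) (add_mem (add_mem (mem _ (by norm_num))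
      (mem _ (by norm_num))) (mem _ (by norm_num)))
    rw [htop ((hom (g 1) 1 0).add (hom (g 2) 0 1)) (mem _ (by norm_num)),
      eq_zero_of_mem_degLT_zero ha, eq_zero_of_mem_degLT_zero hb, zero_mul, zero_mul,
      add_zero] at e
    have e0 := congrArg (eval (Pi.single 0 1)) e
    have e1 := congrArg (eval (Pi.single 1 1)) e
    simp at e0 e1
    exact ⟨e0, e1⟩
  rw [h12.1, h12.2, C_0, zero_mul, zero_mul, zero_add, zero_add] at key
  have h0 : g 0 = 0 := by
    obtain ⟨a, ha, b, hb, e⟩ := key (n := 0) (mem _ (by norm_num))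
    rw [homogeneousComponent_eq_self (hom (g 0) 0 0), eq_zero_of_mem_degLT_zero ha,
      eq_zero_of_mem_degLT_zero hb, zero_mul, zero_mul, add_zero] at e
    simpa using e
  ext i
  fin_cases i
  exacts [h0, h12.1, h12.2, h34.1, h34.2, h5]

end Rank

section Spanning

/-- The principal symbols of degree `n` of the operators in `N`. -/
def symbols (N : Submodule RatFun (Module.End ℂ RatFun)) (n : ℕ) :
    Submodule RatFun (MvPolynomial (Fin 2) RatFun) where
  carrier := {τ | ∃ E ∈ N, ratChart.HasSymbol E n τ}
  add_mem' := by
    rintro _ _ ⟨E, hE, h⟩ ⟨E', hE', h'⟩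
    exact ⟨E + E', add_mem hE hE', h.add h'⟩
  zero_mem' := ⟨0, zero_mem _, 0, ratChart.op_zero, isHomogeneous_zero _ _ _, by
    rw [sub_zero]; exact zero_mem _⟩
  smul_mem' := by
    rintro f _ ⟨E, hE, h⟩
    refine ⟨f • E, Submodule.smul_mem _ _ hE, ?_⟩
    rw [smul_eq_C_mul]
    exact h.mulOp_mul f

theorem symbols_mono {N N' : Submodule RatFun (Module.End ℂ RatFun)} (h : N ≤ N') (n : ℕ) :
    symbols N n ≤ symbols N' n := fun _ ⟨E, hE, hτ⟩ => ⟨E, h hE, hτ⟩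

theorem op_mem_of_symbols {N : Submodule RatFun (Module.End ℂ RatFun)}
    (h : ∀ i j, X 0 ^ i * X 1 ^ j ∈ symbols N (i + j)) (p : MvPolynomial (Fin 2) RatFun) :
    ratChart.op p ∈ N := by
  have key : ∀ n, ∀ p ∈ degLT RatFun n, ratChart.op p ∈ N := by
    intro n
    induction n with
    | zero =>
      intro p hp
      rw [eq_zero_of_mem_degLT_zero hp, Chart.op_zero]
      exact zero_mem _
    | succ n ih =>
      intro p hp
      have htop : homogeneousComponent n p ∈ symbols N n := by
        rw [homogeneousComponent_apply]
        refine sum_mem fun α hα => ?_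
        have hmon : monomial α (coeff α p) = coeff α p • (X 0 ^ α 0 * X 1 ^ α 1) := by
          rw [monomial_eq, Finsupp.prod_fintype _ _ (by simp), Fin.prod_univ_two, smul_eq_C_mul]
        have hdeg : α 0 + α 1 = n := by
          rw [← (Finset.mem_filter.mp hα).2, Finsupp.degree_eq_sum, Fin.sum_univ_two]
        rw [hmon, ← hdeg]
        exact Submodule.smul_mem _ _ (h _ _)
      obtain ⟨E, hE, q, hq, hom, hsub⟩ := htop
      have hpq : p - q ∈ degLT RatFun n := by
        have e : p - q = (p - homogeneousComponent n p) - (q - homogeneousComponent n p) := by ring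
        rw [e]
        exact sub_mem (sub_homogeneousComponent_mem_degLT hp) hsub
      have := add_mem (ih _ hpq) hE
      rwa [← hq, ← Chart.op_add, sub_add_cancel] at this
  exact key _ p (mem_degLT_totalDegree p)

variable (A : Fin 4 → ℂ)

/-- The left ideal generated by `P₁` and `P₂`, as a vector space over `ℂ(t₁, t₂)`. -/
def idealOps : Submodule RatFun (Module.End ℂ RatFun) where
  carrier := {T | ∃ Q ∈ ratIdeal (Z₂ A), (Q : Module.End ℂ RatFun) = T}
  add_mem' := by
    rintro _ _ ⟨Q, hQ, rfl⟩ ⟨R, hR, rfl⟩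
    exact ⟨Q + R, add_mem hQ hR, rfl⟩
  zero_mem' := ⟨0, zero_mem _, rfl⟩
  smul_mem' := by
    rintro f _ ⟨Q, hQ, rfl⟩
    exact ⟨coeffHom f * Q, Ideal.mul_mem_left _ _ hQ, rfl⟩

theorem X_mul_mem_symbols {n : ℕ} {τ : MvPolynomial (Fin 2) RatFun}
    (h : τ ∈ symbols (idealOps A) n) (i : Fin 2) : X i * τ ∈ symbols (idealOps A) (n + 1) := by
  obtain ⟨_, ⟨Q, hQ, rfl⟩, hτ⟩ := h
  have hd : pd i ∈ RatDiffOp := Subring.subset_closure (Or.inr ⟨i, rfl⟩)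
  refine ⟨pd i * Q, ⟨⟨pd i, hd⟩ * Q, Ideal.mul_mem_left _ _ hQ, rfl⟩, ?_⟩
  rw [add_comm n 1]
  exact (Chart.hasSymbol_d i).mul hτ

theorem Z₂_mem_idealOps (j : Fin 2) (h : Z₂ A j ∈ RatDiffOp) : Z₂ A j ∈ idealOps A :=
  ⟨⟨_, h⟩, Ideal.subset_span ⟨j, rfl⟩, rfl⟩

theorem sym₁_mem_symbols : ratFrame.sym₁ ∈ symbols (idealOps A) 2 := by
  have h := ratFrame.hasSymbol_P₁ A
  obtain ⟨p, hp, -⟩ := id h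
  exact ⟨_, Z₂_mem_idealOps A 0 ((mem_ratDiffOp_iff _).mpr ⟨p, hp⟩), h⟩

theorem sym₂_mem_symbols : ratFrame.sym₂ ∈ symbols (idealOps A) 3 := by
  have h := hasSymbol_P₂_ratChart A
  obtain ⟨p, hp, -⟩ := id h
  exact ⟨_, Z₂_mem_idealOps A 1 ((mem_ratDiffOp_iff _).mpr ⟨p, hp⟩), h⟩

theorem mem_of_C_mul_mem {M : Submodule RatFun (MvPolynomial (Fin 2) RatFun)} {f : RatFun}
    (hf : f ≠ 0) {τ : MvPolynomial (Fin 2) RatFun} (h : C f * τ ∈ M) : τ ∈ M := by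
  rw [← smul_eq_C_mul] at h
  exact (Submodule.smul_mem_iff M hf).mp h

theorem C_mul_mem {M : Submodule RatFun (MvPolynomial (Fin 2) RatFun)} (f : RatFun)
    {τ : MvPolynomial (Fin 2) RatFun} (h : τ ∈ M) : C f * τ ∈ M := by
  rw [← smul_eq_C_mul]
  exact Submodule.smul_mem M f h

/-- The coefficient of `ξ₁ξ₂` in the symbol of `P₁`. -/
def midCoeff : RatFun := 2 * (ratFrame.h 0 * ratFrame.h 1 - ratFrame.g 0 * ratFrame.g 1)

theorem ratFrame_sym₁ : ratFrame.sym₁ =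
    C (ratFrame.e 0) * X 0 ^ 2 + C midCoeff * (X 0 * X 1) + C (ratFrame.e 1) * X 1 ^ 2 := rfl

theorem ratFrame_sym₂ : ratFrame.sym₂ =
    C (2 * ratFrame.diff * (ratFrame.h 1 * ratFrame.e 0)) * (X 0 ^ 2 * X 1) +
      C (2 * ratFrame.diff * (ratFrame.h 0 * ratFrame.e 1)) * (X 0 * X 1 ^ 2) := by
  simp only [Chart.Frame.sym₂, C_mul]
  ring

theorem ratFrame_coeff_ne_zero (i j : Fin 2) :
    2 * ratFrame.diff * (ratFrame.h i * ratFrame.e j) ≠ 0 :=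
  mul_ne_zero ratFrame.two_mul_diff_ne_zero (mul_ne_zero (ratFrame.h_ne_zero i)
    (ratFrame.e_ne_zero j))

/-- All monomials of degree `4` are principal symbols of operators in the ideal. -/
theorem quartic_mem_symbols {i j : ℕ} (h : i + j = 4) :
    X 0 ^ i * X 1 ^ j ∈ symbols (idealOps A) 4 := by
  have s₁ := fun i j => X_mul_mem_symbols A (X_mul_mem_symbols A (sym₁_mem_symbols A) i) j
  have s₂ := X_mul_mem_symbols A (sym₂_mem_symbols A)
  have h22 : X 0 ^ 2 * X 1 ^ 2 ∈ symbols (idealOps A) 4 := by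
    refine mem_of_C_mul_mem (mul_ne_zero ratFrame.two_mul_diff_ne_zero
      (pow_ne_zero 2 ratFrame.det_ne_zero)) ?_
    rw [ratFrame.C_mul_X_sq_mul_X_sq]
    have := sub_mem (C_mul_mem (2 * ratFrame.diff * ratFrame.h 0 * ratFrame.h 1) (s₁ 1 0))
      (add_mem (C_mul_mem (ratFrame.h 0) (s₂ 0)) (C_mul_mem (ratFrame.h 1) (s₂ 1)))
    convert this using 1
    ring
  have h31 : X 0 ^ 3 * X 1 ^ 1 ∈ symbols (idealOps A) 4 := by
    refine mem_of_C_mul_mem (ratFrame_coeff_ne_zero 1 0) ?_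
    convert sub_mem (s₂ 0)
      (C_mul_mem (2 * ratFrame.diff * (ratFrame.h 0 * ratFrame.e 1)) h22) using 1
    rw [ratFrame_sym₂]
    ring
  have h13 : X 0 ^ 1 * X 1 ^ 3 ∈ symbols (idealOps A) 4 := by
    refine mem_of_C_mul_mem (ratFrame_coeff_ne_zero 0 1) ?_
    convert sub_mem (s₂ 1)
      (C_mul_mem (2 * ratFrame.diff * (ratFrame.h 1 * ratFrame.e 0)) h22) using 1
    rw [ratFrame_sym₂]
    ring
  have h40 : X 0 ^ 4 * X 1 ^ 0 ∈ symbols (idealOps A) 4 := by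
    refine mem_of_C_mul_mem (ratFrame.e_ne_zero 0) ?_
    convert sub_mem (sub_mem (s₁ 0 0) (C_mul_mem midCoeff h31))
      (C_mul_mem (ratFrame.e 1) h22) using 1
    rw [ratFrame_sym₁]
    ring
  have h04 : X 0 ^ 0 * X 1 ^ 4 ∈ symbols (idealOps A) 4 := by
    refine mem_of_C_mul_mem (ratFrame.e_ne_zero 1) ?_
    convert sub_mem (sub_mem (s₁ 1 1) (C_mul_mem midCoeff h13))
      (C_mul_mem (ratFrame.e 0) h22) using 1
    rw [ratFrame_sym₁]
    ring
  obtain rfl : j = 4 - i := by omega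
  have hi : i ≤ 4 := by omega
  interval_cases i
  exacts [h04, h13, h22, h31, h40]

theorem X_pow_mul_X_pow_mem_symbols (n : ℕ) :
    ∀ i j, i + j = n + 4 → X 0 ^ i * X 1 ^ j ∈ symbols (idealOps A) (n + 4) := by
  induction n with
  | zero => exact fun i j h => quartic_mem_symbols A (by omega)
  | succ n ih =>
    intro i j h
    rcases i with - | i
    · obtain ⟨j, rfl⟩ : ∃ k, j = k + 1 := ⟨j - 1, by omega⟩
      convert X_mul_mem_symbols A (ih 0 j (by omega)) 1 using 1
      ring
    · convert X_mul_mem_symbols A (ih i j (by omega)) 0 using 1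
      ring

/-- Modulo the left ideal, every operator is a combination of the six basis operators: in each
degree the symbols of such operators include all monomials. -/
theorem op_mem_of_basisSymbol_mem {N : Submodule RatFun (Module.End ℂ RatFun)}
    (hI : idealOps A ≤ N) (hb : ∀ k, ratChart.op (basisSymbol k) ∈ N)
    (p : MvPolynomial (Fin 2) RatFun) : ratChart.op p ∈ N := by
  refine op_mem_of_symbols (fun i j => ?_) p
  have hbasis : ∀ (k : Fin 6) (i j : ℕ), basisSymbol k = X 0 ^ i * X 1 ^ j →
      X 0 ^ i * X 1 ^ j ∈ symbols N (i + j) := fun k i j h =>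
    ⟨_, h ▸ hb k, Chart.hasSymbol_op_of_isHomogeneous (isHomogeneous_X_pow_mul_X_pow i j)⟩
  have s₁ := sym₁_mem_symbols A
  have s₁' := fun i => symbols_mono hI _ (X_mul_mem_symbols A s₁ i)
  have s₂ := symbols_mono hI _ (sym₂_mem_symbols A)
  replace s₁ := symbols_mono hI _ s₁
  have h00 : X 0 ^ 0 * X 1 ^ 0 ∈ symbols N 0 := hbasis 0 0 0 (by simp [basisSymbol])
  have h10 : X 0 ^ 1 * X 1 ^ 0 ∈ symbols N 1 := hbasis 1 1 0 (by simp [basisSymbol])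
  have h01 : X 0 ^ 0 * X 1 ^ 1 ∈ symbols N 1 := hbasis 2 0 1 (by simp [basisSymbol])
  have h20 : X 0 ^ 2 * X 1 ^ 0 ∈ symbols N 2 := hbasis 3 2 0 (by simp [basisSymbol])
  have h11 : X 0 ^ 1 * X 1 ^ 1 ∈ symbols N 2 := hbasis 4 1 1 (by simp [basisSymbol])
  have h21 : X 0 ^ 2 * X 1 ^ 1 ∈ symbols N 3 := hbasis 5 2 1 (by simp [basisSymbol])
  have h02 : X 0 ^ 0 * X 1 ^ 2 ∈ symbols N 2 := by
    refine mem_of_C_mul_mem (ratFrame.e_ne_zero 1) ?_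
    convert sub_mem (sub_mem s₁ (C_mul_mem midCoeff h11)) (C_mul_mem (ratFrame.e 0) h20) using 1
    rw [ratFrame_sym₁]
    ring
  have h12 : X 0 ^ 1 * X 1 ^ 2 ∈ symbols N 3 := by
    refine mem_of_C_mul_mem (ratFrame_coeff_ne_zero 0 1) ?_
    convert sub_mem s₂
      (C_mul_mem (2 * ratFrame.diff * (ratFrame.h 1 * ratFrame.e 0)) h21) using 1
    rw [ratFrame_sym₂]
    ring
  have h30 : X 0 ^ 3 * X 1 ^ 0 ∈ symbols N 3 := by
    refine mem_of_C_mul_mem (ratFrame.e_ne_zero 0) ?_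
    convert sub_mem (sub_mem (s₁' 0) (C_mul_mem midCoeff h21))
      (C_mul_mem (ratFrame.e 1) h12) using 1
    rw [ratFrame_sym₁]
    ring
  have h03 : X 0 ^ 0 * X 1 ^ 3 ∈ symbols N 3 := by
    refine mem_of_C_mul_mem (ratFrame.e_ne_zero 1) ?_
    convert sub_mem (sub_mem (s₁' 1) (C_mul_mem midCoeff h12))
      (C_mul_mem (ratFrame.e 0) h21) using 1
    rw [ratFrame_sym₁]
    ring
  rcases Nat.lt_or_ge (i + j) 4 with hlt | hge
  · generalize hn : i + j = n at hlt ⊢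
    obtain rfl : j = n - i := by omega
    have hi : i ≤ n := by omega
    clear hn
    interval_cases n
    · interval_cases i
      exact h00
    · interval_cases i
      exacts [h01, h10]
    · interval_cases i
      exacts [h02, h11, h20]
    · interval_cases i
      exacts [h03, h12, h21, h30]
  · obtain ⟨n, hn⟩ : ∃ n, i + j = n + 4 := ⟨i + j - 4, by omega⟩
    rw [hn]
    exact symbols_mono hI _ (X_pow_mul_X_pow_mem_symbols A n i j hn)

/-- The basis operators. -/
def basisOp (k : Fin 6) : RatDiffOp :=
  ⟨ratChart.op (basisSymbol k), (mem_ratDiffOp_iff _).mpr ⟨_, rfl⟩⟩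

theorem rank_quotient_eq_six {M : Type*} [AddCommGroup M] [Module RatFun M] (π : RatDiffOp →+ M)
    (hπ : Function.Surjective π) (hsmul : ∀ f Q, π (coeffHom f * Q) = f • π Q)
    (hker : ∀ Q, π Q = 0 ↔ Q ∈ ratIdeal (Z₂ A)) : Module.rank RatFun M = 6 := by
  have hli : LinearIndependent RatFun fun k => π (basisOp k) := by
    rw [Fintype.linearIndependent_iff]
    intro g hg
    have hmem : ∑ k, coeffHom (g k) * basisOp k ∈ ratIdeal (Z₂ A) := by
      rw [← hker, map_sum, ← hg]
      exact Finset.sum_congr rfl fun k _ => hsmul _ _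
    refine congrFun (eq_zero_of_sum_mem_ratIdeal A hmem ?_)
    rw [Chart.op_sum, AddSubmonoidClass.coe_finsetSum]
    exact Finset.sum_congr rfl fun k _ => ratChart.op_C_mul _ _
  have hspan : ⊤ ≤ Submodule.span RatFun (Set.range fun k => π (basisOp k)) := by
    let N : Submodule RatFun (Module.End ℂ RatFun) :=
      { carrier := {T | ∃ Q : RatDiffOp, (Q : Module.End ℂ RatFun) = T ∧
          π Q ∈ Submodule.span RatFun (Set.range fun k => π (basisOp k))}
        add_mem' := by
          rintro _ _ ⟨Q, rfl, hQ⟩ ⟨R, rfl, hR⟩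
          exact ⟨Q + R, rfl, by rw [map_add]; exact add_mem hQ hR⟩
        zero_mem' := ⟨0, rfl, by rw [map_zero]; exact zero_mem _⟩
        smul_mem' := by
          rintro f _ ⟨Q, rfl, hQ⟩
          exact ⟨coeffHom f * Q, rfl, by rw [hsmul]; exact Submodule.smul_mem _ f hQ⟩ }
    have hI : idealOps A ≤ N := by
      rintro _ ⟨Q, hQ, rfl⟩
      exact ⟨Q, rfl, by rw [(hker Q).mpr hQ]; exact zero_mem _⟩
    have hb : ∀ k, ratChart.op (basisSymbol k) ∈ N := fun k =>
      ⟨basisOp k, rfl, Submodule.subset_span ⟨k, rfl⟩⟩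
    intro y _
    obtain ⟨Q, rfl⟩ := hπ y
    obtain ⟨p, hp⟩ := (mem_ratDiffOp_iff _).mp Q.2
    obtain ⟨R, hR, hmem⟩ := op_mem_of_basisSymbol_mem A hI hb p
    rwa [Subtype.ext (hR.trans hp)] at hmem
  have := rank_eq_card_basis (Module.Basis.mk hli hspan)
  rw [Fintype.card_fin] at this
  exact this

theorem rank_Z₂ : rank (Z₂ A) = 6 := by
  rw [rank]
  exact @rank_quotient_eq_six A _ _ (Module.compHom _ coeffHom)
    (Submodule.mkQ (ratIdeal (Z₂ A))).toAddMonoidHom (Submodule.mkQ_surjective _)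
    (fun _ _ => rfl) fun Q => Submodule.Quotient.mk_eq_zero _

end Spanning

end ZSystem

end

theorem theorem3p1 (A : Fin 4 → ℂ) :
    ZSystem.rank (ZSystem.Z₂ A) = 6 ∧
    ZSystem.singularLocus (ZSystem.Z₂ A) =
      {x | (∃ i, x i = ((1 : ℂ) : OnePoint ℂ) ∨ x i = ((-1 : ℂ) : OnePoint ℂ) ∨
        x i = OnePoint.infty) ∨ x 0 = x 1} :=
  ⟨ZSystem.rank_Z₂ A, ZSystem.singularLocus_Z₂ A⟩
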